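/- Let $T$ be a tree (a nonempty finite connected acyclic graph) with vertex set $V$, and let $\rho\in V$ be a root. **Arboreal singularity.** For $\alpha\in V$ let $L_T(\alpha)=\mathbb R^{V\setminus\{\alpha\}}$, with coordinates $x_\gamma(\alpha)$. The arboreal singularity $L_T$ is the quotient space of $\coprod_{\alpha} L_T(\alpha)$ by the equivalence relation generated by identifying, for each edge $\{\alpha,\beta\}$, points of $L_T(\alpha)$ and $L_T(\beta)$ with $x_\beta(\alpha)=x_\alpha(\beta)\ge 0$ and $x_\gamma(\alpha)=x_\gamma(\beta)$ for all $\gamma\ne\alpha,\beta$. **Smoothed arboreal hypersurface.** Let $b:\mathbb R_{>0}\to\mathbb R$ be any $C^1$ function with $b\le 0$, $\lim_{t\to0}b(t)=0$, $\lim_{t\to 0}b'(t)=-\infty$, and $b(t)=0$ for $t\gg0$. Let $f:\mathbb R^2\to\mathbb R$ be any $C^1$ submersion with $\{f=0\}=\{x_1=0,x_2\ge0\}\cup\{x_1>0,x_2=b(x_1)\}$, $\{f>0\}=\{x_1>0,x_2>b(x_1)\}$, and $f<0$ elsewhere. On $\mathbb R^{\mathcal T}=\mathbb R^V$ put $h_\rho=x_\rho$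 and, for $\alpha\ne\rho$ with parent $\hat\alpha$ (the vertex adjacent to $\alpha$ and nearer to $\rho$), $h_\alpha=f(h_{\hat\alpha},x_\alpha)$. Let $Q_\alpha=\{h_\alpha\ge0\}$, $H_\alpha=\{h_\alpha=0\}$ and $H_{\mathcal T}=\bigcup_\alpha H_\alpha$. **Coline and coray bundles.** For a closed $H\subset\mathbb R^V$ let $H^{sm}$ be the set of points near which $H$ is a $C^1$ submanifold of codimension one. Let $\mathcal L^*_H\subset P^*\mathbb R^V$ and $\mathcal R^*_H\subset S^*\mathbb R^V$ be the closures of the sets of conormal lines, respectively conormal rays, of $H^{sm}$ (the coline and coray bundles). Say that $H$ is in good position if $H^{sm}$ is dense in $H$ and the projection $\pi:\mathcal L^*_H\to H$ is finite (proper with finite fibers). A coorientation of such an $H$ is a continuous section $\sigma$ of $\mathcal R^*_H\to\mathcal L^*_H$; its positive ray bundle is $\sigma(\mathcal L^*_H)\subset S^*\mathbb R^V$. **Theorem.** $H_{\mathcal T}$ and all the $H_\alpha$ are in good position. Each $H_\alpha$ has a coorientation $\sigma_\alpha$ pointing towards $Q_\alpha$, and $\mathcal L^*_{H_\alpha}\subset\mathcal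 L^*_{H_{\mathcal T}}$. 1. There is a unique coorientation $\sigma$ of $H_{\mathcal T}$ whose restriction to each $H_\alpha$ is $\sigma_\alpha$. 2. There is a homeomorphism $\varphi:L_T\to\mathcal L^*_{H_{\mathcal T}}$ such that, for every $\alpha\in V$, the map $\pi\circ\varphi$ restricts to a homeomorphism $L_T(\alpha)\to H_\alpha$. Moreover $\sigma\circ\varphi$ is a homeomorphism from $L_T$ onto the positive ray bundle $\sigma(\mathcal L^*_{H_{\mathcal T}})\subset S^*\mathbb R^V$ (the conormal Legendrian of $H_{\mathcal T}$). -/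

import Mathlib

open Set Filter Topology
open scoped LinearAlgebra.Projectivization

noncomputable section

namespace Arboreal

/-! ### The arboreal singularity of a tree -/

section Singularity

variable {V : Type*} (T : SimpleGraph V)

/-- The Euclidean space of real tuples `x_γ(α)`, indexed by the vertices `γ ≠ α`. -/
abbrev Piece (α : V) : Type _ := {γ : V // γ ≠ α} → ℝ

/-- The edge gluings: for an edge `{α, β}`, the points `x` of the piece of `α` and `y` of the
piece of `β` are identified if `x_β = y_α ≥ 0` and `x_γ = y_γ` for all `γ ≠ α, β`. -/
def EdgeGluing (x y : Σ α : V, Piece α) : Prop :=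
  ∃ h : T.Adj x.1 y.1,
    x.2 ⟨y.1, h.ne'⟩ = y.2 ⟨x.1, h.ne⟩ ∧ 0 ≤ x.2 ⟨y.1, h.ne'⟩ ∧
    ∀ (γ : V) (hx : γ ≠ x.1) (hy : γ ≠ y.1), x.2 ⟨γ, hx⟩ = y.2 ⟨γ, hy⟩

/-- The arboreal singularity: the quotient (with the quotient topology) of the disjoint union of
the pieces by the equivalence relation generated by the edge gluings. -/
abbrev Singularity : Type _ := Quot (EdgeGluing T)

/-- The canonical map from the Euclidean piece of `α` to the arboreal singularity. -/
def Singularity.ofPiece (α : V) (x : Piece α) : Singularity T := Quot.mk _ ⟨α, x⟩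

end Singularity

/-! ### The smoothed arboreal hypersurface of a rooted tree -/

/-- The conditions on `b : ℝ_{>0} → ℝ`; only the values of `b` on `ℝ_{>0}` matter. -/
structure IsProfile (b : ℝ → ℝ) : Prop where
  contDiffOn : ContDiffOn ℝ 1 b (Ioi 0)
  nonpos : ∀ t, 0 < t → b t ≤ 0
  tendsto_zero : Tendsto b (𝓝[>] 0) (𝓝 0)
  tendsto_deriv : Tendsto (deriv b) (𝓝[>] 0) atBot
  eventually_zero : ∀ᶠ t in atTop, b t = 0

/-- The conditions on `f : ℝ² → ℝ`, relative to `b`. -/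
structure IsSmoothing (b : ℝ → ℝ) (f : ℝ × ℝ → ℝ) : Prop where
  contDiff : ContDiff ℝ 1 f
  submersion : ∀ p, Function.Surjective (fderiv ℝ f p)
  eq_zero_iff : ∀ s t, f (s, t) = 0 ↔ (s = 0 ∧ 0 ≤ t) ∨ (0 < s ∧ t = b s)
  pos_iff : ∀ s t, 0 < f (s, t) ↔ 0 < s ∧ b s < t
  neg_iff : ∀ s t, f (s, t) < 0 ↔ s < 0 ∨ (s = 0 ∧ t < 0) ∨ (0 < s ∧ t < b s)

section Hypersurface

variable {V : Type*} (T : SimpleGraph V) (ρ : V)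

/-- `β` is a parent of `α` in the tree `T` rooted at `ρ`: the vertices `β` and `α` are adjacent
and `β` is nearer to `ρ`. -/
def IsParent (β α : V) : Prop := T.Adj β α ∧ T.dist ρ β < T.dist ρ α

open Classical in
/-- The functions `h_α`: one has `h_ρ = x_ρ` for the root (which has no parent), and
`h_α = f (h_β, x_α)` for `α ≠ ρ`, where `β` is the parent of `α`. -/
def height (f : ℝ × ℝ → ℝ) (α : V) (x : V → ℝ) : ℝ :=
  if h : ∃ β, IsParent T ρ β α then f (height f h.choose x, x α) else x α
termination_by T.dist ρ α
decreasing_by exact h.choose_spec.2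

/-- The halfspace `Q_α = {h_α ≥ 0}`. -/
def halfspace (f : ℝ × ℝ → ℝ) (α : V) : Set (V → ℝ) := {x | 0 ≤ height T ρ f α x}

/-- The hypersurface `H_α = {h_α = 0}`. -/
def vertexHypersurface (f : ℝ × ℝ → ℝ) (α : V) : Set (V → ℝ) := {x | height T ρ f α x = 0}

/-- The smoothed arboreal hypersurface, the union of the hypersurfaces `H_α`. -/
def smoothedHypersurface (f : ℝ × ℝ → ℝ) : Set (V → ℝ) := ⋃ α, vertexHypersurface T ρ f α

end Hypersurface

/-! ### Coline and coray bundles, good position, coorientations -/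

/-- The quotient topology on the projective space of lines in `W`. -/
instance {W : Type*} [AddCommGroup W] [Module ℝ W] [TopologicalSpace W] :
    TopologicalSpace (ℙ ℝ W) :=
  .coinduced (fun v : {v : W // v ≠ 0} => Projectivization.mk ℝ v.1 v.2) inferInstance

/-- The quotient topology on the space of rays in `W`. -/
instance {W : Type*} [AddCommGroup W] [Module ℝ W] [TopologicalSpace W] :
    TopologicalSpace (Module.Ray ℝ W) :=
  .coinduced (fun v : {v : W // v ≠ 0} => rayOfNeZero ℝ v.1 v.2) inferInstance

section Microlocal

variable (E : Type*) [NormedAddCommGroup E] [NormedSpace ℝ E]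

/-- The projectivized cotangent bundle `P^*E = E × P(E^*)` of the vector space `E`. -/
abbrev CotangentLines : Type _ := E × ℙ ℝ (StrongDual ℝ E)

/-- The spherically projectivized cotangent bundle `S^*E` of the vector space `E`. -/
abbrev CotangentRays : Type _ := E × Module.Ray ℝ (StrongDual ℝ E)

variable {E}

/-- The line through a ray. -/
def lineOfRay (r : Module.Ray ℝ (StrongDual ℝ E)) : ℙ ℝ (StrongDual ℝ E) :=
  Projectivization.mk ℝ r.someVector r.someVector_ne_zero

theorem lineOfRay_rayOfNeZero (v : StrongDual ℝ E) (hv : v ≠ 0) :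
    lineOfRay (rayOfNeZero ℝ v hv) = Projectivization.mk ℝ v hv := by
  unfold lineOfRay
  rw [Projectivization.mk_eq_mk_iff']
  have h := (rayOfNeZero ℝ v hv).someVector_ray
  rw [ray_eq_iff] at h
  obtain ⟨r, -, hr⟩ := h.exists_pos_right (Module.Ray.someVector_ne_zero _) hv
  exact ⟨r, hr.symm⟩

/-- `g` is a local equation of `H` near `x` as a `C^1` hypersurface. -/
structure IsLocalEquation (H : Set E) (x : E) (g : E → ℝ) : Prop where
  contDiffAt : ContDiffAt ℝ 1 g x
  fderiv_ne_zero : fderiv ℝ g x ≠ 0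
  mem_iff : ∀ᶠ y in 𝓝 x, y ∈ H ↔ g y = 0

/-- The smooth locus `H^sm`: the points of `H` near which `H` is a `C^1` submanifold of
codimension one. -/
def smoothLocus (H : Set E) : Set E := {x ∈ H | ∃ g, IsLocalEquation H x g}

/-- `v` is conormal to `H` at the smooth point `x`, i.e. it vanishes on the tangent space
`T_x H = ker dg`, where `g` is a local equation of `H` near `x`. -/
def IsConormal (H : Set E) (x : E) (v : StrongDual ℝ E) : Prop :=
  ∃ g, IsLocalEquation H x g ∧ ∀ w, fderiv ℝ g x w = 0 → v w = 0

/-- `L^*_H`: the closure in `P^*E` of the projectivized conormal bundle of `H^sm`. -/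
def colineBundle (H : Set E) : Set (CotangentLines E) :=
  closure {p | p.1 ∈ smoothLocus H ∧
    ∃ (v : StrongDual ℝ E) (hv : v ≠ 0), IsConormal H p.1 v ∧ p.2 = Projectivization.mk ℝ v hv}

/-- `R^*_H`: the closure in `S^*E` of the spherically projectivized conormal bundle of `H^sm`. -/
def corayBundle (H : Set E) : Set (CotangentRays E) :=
  closure {p | p.1 ∈ smoothLocus H ∧
    ∃ (v : StrongDual ℝ E) (hv : v ≠ 0), IsConormal H p.1 v ∧ p.2 = rayOfNeZero ℝ v hv}

/-- The front projection of the coline bundle. Its values lie in the closure of `H`. -/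
def front (H : Set E) (p : colineBundle H) : E := p.1.1

/-- `H` is a hypersurface in good position: it is closed, its smooth locus is dense in it, and its
coline bundle is finite over it (the front projection is proper with finite fibers). -/
structure IsInGoodPosition (H : Set E) : Prop where
  isClosed : IsClosed H
  dense_smoothLocus : H ⊆ closure (smoothLocus H)
  isProperMap_front : IsProperMap (front H)
  finite_fiber : ∀ x, (front H ⁻¹' {x}).Finite

/-- A coorientation: a continuous section of the natural map `R^*_H → L^*_H`. -/
structure Coorientation (H : Set E) where
  toFun : colineBundle H → corayBundle H
  continuous_toFun : Continuous toFun
  isSection : ∀ p, ((toFun p).1.1, lineOfRay (toFun p).1.2) = p.1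

/-- The positive ray bundle of a coorientation: its image in `S^*E`. -/
def Coorientation.positiveRayBundle {H : Set E} (σ : Coorientation H) : Set (CotangentRays E) :=
  range fun p => (σ.toFun p).1

/-- `σ`, a coorientation of `H`, restricts to the coorientation `τ` of `K`. -/
def Coorientation.RestrictsTo {H K : Set E} (σ : Coorientation H) (τ : Coorientation K) : Prop :=
  ∀ p : colineBundle K, ∃ hp : p.1 ∈ colineBundle H, (σ.toFun ⟨p.1, hp⟩).1 = (τ.toFun p).1

/-- The codirection `[v]` at `x` points towards `Q`: every tangent vector on which `v` is positive
points from `x` into `Q`. -/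
def PointsTowards (p : CotangentRays E) (Q : Set E) : Prop :=
  ∃ (v : StrongDual ℝ E) (hv : v ≠ 0), p.2 = rayOfNeZero ℝ v hv ∧
    ∀ w : E, 0 < v w → ∀ᶠ t in 𝓝[>] (0 : ℝ), p.1 + t • w ∈ Q

end Microlocal

end Arboreal

end

open Arboreal

noncomputable section

namespace Arboreal

/-! ### Topology of the spaces of lines and rays -/

section Quotients

variable {W : Type*} [AddCommGroup W] [Module ℝ W] [TopologicalSpace W]

/-! Each `H_α` is cut out by the `C^1` function `h_α`, which is regular along it. In a finite union
of regular hypersurfaces `K i`, Baire category shows that the coline bundle of the union is the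
union of the conormal line sections of the members (`colineBundle_iUnion`). Each section is closed
and homeomorphic to its `K i`, so good position follows (`isInGoodPosition_iUnion`).

Let `β` be the parent of `α` and take a point of `H_α`. If `h_β` vanishes there, the point lies over
the vertical ray of `{f = 0}`, where `df` is a positive multiple of the first coordinate covector;
hence `dh_α` is a positive multiple of `dh_β`, and the two conormal rays agree. If `h_β ≠ 0` there,
`dh_α` has a positive component along `x_α`.

Topologically, after a shear by `b`, the function `f (s, t)` has the sign of `min s t`, and a
piecewise linear fold turns a quadrant into a halfspace. Composing folds and shears down the tree
gives homeomorphisms of `ℝ^V` carrying `x_α = 0` to `H_α`. On `x_α = 0` the fold is exactly the edge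
gluing, so points of adjacent pieces are glued if and only if their images in `ℝ^V` coincide
(`edgeGluing_iff`).

The rays of the `dh_α` thus define a continuous map on the arboreal singularity, surjective onto the
coline bundle. For injectivity, every point can be moved up the tree to a piece `γ` where `dh_γ` has
a nonzero `x_γ` component. Since `dh_γ` otherwise involves only vertices nearer to the root, its
line determines `γ`, and the base point then determines the point of the piece. The map is closed
because there are finitely many pieces, hence a homeomorphism; the rays themselves provide the
coorientation. -/

theorem continuous_projectivizationMk :
    Continuous (fun v : {v : W // v ≠ 0} => Projectivization.mk ℝ v.1 v.2) :=
  continuous_coinduced_rng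

theorem continuous_rayOfNeZero :
    Continuous (fun v : {v : W // v ≠ 0} => rayOfNeZero ℝ v.1 v.2) :=
  continuous_coinduced_rng

theorem isOpenQuotientMap_projectivizationMk [ContinuousSMul ℝ W] :
    IsOpenQuotientMap (fun v : {v : W // v ≠ 0} => Projectivization.mk ℝ v.1 v.2) := by
  refine ⟨?_, continuous_projectivizationMk, ?_⟩
  · intro p
    exact ⟨⟨p.rep, p.rep_nonzero⟩, p.mk_rep⟩
  · intro U hU
    change IsOpen[TopologicalSpace.coinduced _ _] _
    rw [isOpen_coinduced]
    -- The saturation of an open set is the union of its nonzero rescalings.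
    have key : (fun v : {v : W // v ≠ 0} => Projectivization.mk ℝ v.1 v.2) ⁻¹'
        ((fun v : {v : W // v ≠ 0} => Projectivization.mk ℝ v.1 v.2) '' U) =
        ⋃ c : ℝˣ, (fun v : {v : W // v ≠ 0} =>
          (⟨c • v.1, by simpa [Units.smul_def] using v.2⟩ : {v : W // v ≠ 0})) ⁻¹' U := by
      ext v
      simp only [mem_preimage, mem_image, mem_iUnion, Projectivization.mk_eq_mk_iff]
      constructor
      · rintro ⟨u, hu, c, hc⟩
        refine ⟨c, ?_⟩
        convert hu
      · rintro ⟨c, hc⟩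
        exact ⟨_, hc, c, rfl⟩
    rw [key]
    refine isOpen_iUnion fun c => hU.preimage ?_
    refine Continuous.subtype_mk ?_ _
    simp only [Units.smul_def]
    fun_prop

end Quotients

section Dual

variable {E : Type*} [NormedAddCommGroup E] [NormedSpace ℝ E]

/-- For an open quotient map it suffices that the relation be closed, and proportionality of
covectors is given by the vanishing of all `2 × 2` minors. -/
instance : T2Space (ℙ ℝ (StrongDual ℝ E)) := by
  rw [t2Space_iff_of_isOpenQuotientMap isOpenQuotientMap_projectivizationMk]
  have key : {q : {v : StrongDual ℝ E // v ≠ 0} × {v : StrongDual ℝ E // v ≠ 0} |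
      Projectivization.mk ℝ q.1.1 q.1.2 = Projectivization.mk ℝ q.2.1 q.2.2} =
      ⋂ (a : E) (c : E), {q | q.1.1 a * q.2.1 c = q.1.1 c * q.2.1 a} := by
    ext ⟨⟨v, hv⟩, ⟨w, hw⟩⟩
    simp only [mem_ofPred_eq, mem_iInter, Projectivization.mk_eq_mk_iff']
    constructor
    · rintro ⟨k, rfl⟩ a c
      simp only [_root_.smul_apply, smul_eq_mul]
      ring
    · intro h
      obtain ⟨a, ha⟩ : ∃ a, w a ≠ 0 := by
        by_contra! h0
        exact hw (ContinuousLinearMap.ext h0)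
      refine ⟨v a / w a, ?_⟩
      ext c
      simp only [_root_.smul_apply, smul_eq_mul]
      field_simp
      linarith [h a c]
  rw [key]
  refine isClosed_iInter fun a => isClosed_iInter fun c => isClosed_eq ?_ ?_ <;> fun_prop

theorem continuous_lineOfRay : Continuous (lineOfRay (E := E)) := by
  rw [continuous_coinduced_dom]
  refine continuous_projectivizationMk.congr fun v => ?_
  exact (lineOfRay_rayOfNeZero v.1 v.2).symm

end Dual

/-! ### Local equations -/

section LocalEquations

variable {E : Type*} [NormedAddCommGroup E] [NormedSpace ℝ E]

theorem eventually_differentiableAt {g : E → ℝ} {x : E} (hg : ContDiffAt ℝ 1 g x) :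
    ∀ᶠ y in 𝓝 x, DifferentiableAt ℝ g y :=
  (hg.eventually (by simp)).mono fun _ h => h.differentiableAt (by simp)

theorem eventually_fderiv_pos {g : E → ℝ} {x w : E} (hg : ContDiffAt ℝ 1 g x)
    (hw : 0 < fderiv ℝ g x w) : ∀ᶠ y in 𝓝 x, 0 < fderiv ℝ g y w := by
  have h : ContinuousAt (fun y => fderiv ℝ g y w) x :=
    (hg.continuousAt_fderiv (by simp)).clm_apply continuousAt_const
  exact h.eventually (lt_mem_nhds hw)

theorem add_smul_mem_ball {x w y : E} {r ε t : ℝ} (hy : y ∈ Metric.ball x (r / 2))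
    (hε : ε * ‖w‖ < r / 2) (ht : t ∈ Icc (-ε) ε) : y + t • w ∈ Metric.ball x r := by
  rw [Metric.mem_ball, dist_eq_norm] at *
  calc ‖y + t • w - x‖ = ‖(y - x) + t • w‖ := by congr 1; abel
    _ ≤ ‖y - x‖ + ‖t • w‖ := norm_add_le _ _
    _ ≤ ‖y - x‖ + ε * ‖w‖ := by
      rw [norm_smul]
      gcongr
      exact abs_le.mpr ht
    _ < r := by linarith

theorem strictMonoOn_line {g : E → ℝ} {x w y : E} {r ε : ℝ}
    (hd : ∀ z ∈ Metric.ball x r, DifferentiableAt ℝ g z ∧ 0 < fderiv ℝ g z w)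
    (hy : y ∈ Metric.ball x (r / 2)) (hε : ε * ‖w‖ < r / 2) :
    StrictMonoOn (fun t : ℝ => g (y + t • w)) (Icc (-ε) ε) := by
  have hmem : ∀ t ∈ Icc (-ε) ε, y + t • w ∈ Metric.ball x r := fun t => add_smul_mem_ball hy hε
  have hder : ∀ t ∈ Icc (-ε) ε,
      HasDerivAt (fun t : ℝ => g (y + t • w)) (fderiv ℝ g (y + t • w) w) t := by
    intro t ht
    have h1 : HasDerivAt (fun t : ℝ => y + t • w) w t := by
      simpa using ((hasDerivAt_id t).smul_const w).const_add y
    exact (hd _ (hmem t ht)).1.hasFDerivAt.comp_hasDerivAt t h1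
  refine strictMonoOn_of_deriv_pos (convex_Icc _ _)
    (fun t ht => (hder t ht).continuousAt.continuousWithinAt) fun t ht => ?_
  have ht' := interior_subset ht
  rw [(hder t ht').deriv]
  exact (hd _ (hmem t ht')).2

/-- If the zero locus of `g` is contained in the zero locus of `g'` near a regular point of both,
with common transversal direction `w`, then the loci agree near the point. -/
theorem eventually_zero_of_zero_imp_zero_aux {g g' : E → ℝ} {x w : E} (hg : ContDiffAt ℝ 1 g x)
    (hg' : ContDiffAt ℝ 1 g' x) (hx : g x = 0) (hw : 0 < fderiv ℝ g x w)
    (hw' : 0 < fderiv ℝ g' x w) (himp : ∀ᶠ y in 𝓝 x, g y = 0 → g' y = 0) :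
    ∀ᶠ y in 𝓝 x, g' y = 0 → g y = 0 := by
  obtain ⟨r, hr, hball⟩ := Metric.eventually_nhds_iff_ball.mp
    ((((eventually_differentiableAt hg).and (eventually_fderiv_pos hg hw)).and
      ((eventually_differentiableAt hg').and (eventually_fderiv_pos hg' hw'))).and himp)
  obtain ⟨ε, hε, hεr⟩ : ∃ ε : ℝ, 0 < ε ∧ ε * ‖w‖ < r / 2 := by
    refine ⟨r / 4 / (‖w‖ + 1), by positivity, ?_⟩
    rw [div_mul_eq_mul_div, div_lt_iff₀ (by positivity)]
    nlinarith [norm_nonneg w]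
  have hmono : ∀ {y}, y ∈ Metric.ball x (r / 2) → _ := fun hy =>
    strictMonoOn_line (ε := ε) (fun z hz => (hball z hz).1.1) hy hεr
  have hmono' : ∀ {y}, y ∈ Metric.ball x (r / 2) → _ := fun hy =>
    strictMonoOn_line (ε := ε) (fun z hz => (hball z hz).1.2) hy hεr
  have mem0 : (0 : ℝ) ∈ Icc (-ε) ε := ⟨by linarith, hε.le⟩
  have memr : ε ∈ Icc (-ε) ε := ⟨by linarith, le_rfl⟩
  have meml : -ε ∈ Icc (-ε) ε := ⟨le_rfl, by linarith⟩
  have hxb : x ∈ Metric.ball x (r / 2) := Metric.mem_ball_self (by positivity)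
  have hxm := hmono hxb
  have hinside : ∀ t ∈ Icc (-ε) ε, ∀ y ∈ Metric.ball x (r / 2), y + t • w ∈ Metric.ball x r :=
    fun t ht y hy => add_smul_mem_ball hy hεr ht
  have hcont : ∀ t ∈ Icc (-ε) ε, ContinuousAt (fun y => g (y + t • w)) x := fun t ht =>
    ContinuousAt.comp (g := g) (hball _ (hinside t ht x hxb)).1.1.1.continuousAt (by fun_prop)
  -- Near `x`, the function `g` changes sign along the segment through `y` in direction `w`. Its
  -- zero there is also a zero of `g'`, which is injective on the segment; if `g' y = 0`, the zero
  -- is `y` itself.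
  have hpos : ∀ᶠ y in 𝓝 x, 0 < g (y + ε • w) := by
    refine (hcont ε memr).eventually (lt_mem_nhds ?_)
    simpa [hx] using hxm mem0 memr hε
  have hneg : ∀ᶠ y in 𝓝 x, g (y + (-ε) • w) < 0 := by
    refine (hcont (-ε) meml).eventually (gt_mem_nhds ?_)
    simpa [hx] using hxm meml mem0 (by linarith)
  filter_upwards [hpos, hneg, Metric.ball_mem_nhds x (half_pos hr)] with y h1 h2 hy hzero
  have hc : ContinuousOn (fun t : ℝ => g (y + t • w)) (Icc (-ε) ε) := fun t ht =>
    (ContinuousAt.comp (g := g) (f := fun t : ℝ => y + t • w) (hball _ (hinside t ht y hy)).1.1.1.continuousAt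
      (by fun_prop)).continuousWithinAt
  obtain ⟨t, ht, hgt⟩ := intermediate_value_Icc (by linarith) hc ⟨h2.le, h1.le⟩
  have h3 := (hball _ (hinside t ht y hy)).2 hgt
  have : t = 0 := (hmono' hy).injOn ht mem0 (by simpa [hzero] using h3)
  simpa [this] using hgt

theorem eventually_zero_of_zero_imp_zero {g g' : E → ℝ} {x w : E} (hg : ContDiffAt ℝ 1 g x)
    (hg' : ContDiffAt ℝ 1 g' x) (hx : g x = 0) (hw : fderiv ℝ g x w ≠ 0)
    (hw' : fderiv ℝ g' x w ≠ 0) (himp : ∀ᶠ y in 𝓝 x, g y = 0 → g' y = 0) :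
    ∀ᶠ y in 𝓝 x, g' y = 0 → g y = 0 := by
  rcases hw.lt_or_gt with h | h <;> rcases hw'.lt_or_gt with h' | h'
  · exact eventually_zero_of_zero_imp_zero_aux (w := -w) hg hg' hx (by simpa) (by simpa) himp
  · have := eventually_zero_of_zero_imp_zero_aux (g := -g) (g' := g') hg.neg hg' (by simpa)
      (w := w) (by simpa [fderiv_neg] using h) h' (by simpa using himp)
    simpa using this
  · have := eventually_zero_of_zero_imp_zero_aux (g := g) (g' := -g') hg hg'.neg hx
      (w := w) h (by simpa [fderiv_neg] using h') (by simpa using himp)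
    simpa using this
  · exact eventually_zero_of_zero_imp_zero_aux hg hg' hx h h' himp

/-- Inclusion of regular zero loci forces the differentials to be proportional. -/
theorem exists_fderiv_eq_smul [CompleteSpace E] {g g' : E → ℝ} {x : E} (hg : ContDiffAt ℝ 1 g x)
    (hg' : ContDiffAt ℝ 1 g' x) (hx : g x = 0) (hd : fderiv ℝ g x ≠ 0)
    (hd' : fderiv ℝ g' x ≠ 0) (himp : ∀ᶠ y in 𝓝 x, g y = 0 → g' y = 0) :
    ∃ c : ℝ, c ≠ 0 ∧ fderiv ℝ g' x = c • fderiv ℝ g x := by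
  -- Near `x`, `g'` is constant on the level set of `g`, so Lagrange multipliers apply; both
  -- multipliers are nonzero because both differentials are.
  have hext : IsLocalExtrOn g' {y | g y = g x} x := by
    left
    have hx' := himp.self_of_nhds hx
    filter_upwards [himp.filter_mono nhdsWithin_le_nhds, self_mem_nhdsWithin] with y h1 h2
    rw [h1 (h2.trans hx), hx']
  obtain ⟨a, c, hne, hac⟩ := hext.exists_multipliers_of_hasStrictFDerivAt_1d
    (hg.hasStrictFDerivAt (by simp)) (hg'.hasStrictFDerivAt (by simp))
  have hc : c ≠ 0 := by
    rintro rfl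
    have ha : a ≠ 0 := by
      rintro rfl
      exact hne rfl
    simp only [zero_smul, add_zero] at hac
    exact hd ((smul_eq_zero.mp hac).resolve_left ha)
  have ha : a ≠ 0 := by
    rintro rfl
    simp only [zero_smul, zero_add] at hac
    exact hd' ((smul_eq_zero.mp hac).resolve_left hc)
  refine ⟨-(a / c), neg_ne_zero.mpr (div_ne_zero ha hc), ?_⟩
  rw [add_comm] at hac
  rw [← inv_smul_smul₀ hc (fderiv ℝ g' x), eq_neg_of_add_eq_zero_left hac, smul_neg, smul_smul,
    neg_smul, inv_mul_eq_div]

theorem exists_eq_smul_of_ker_le {u v : StrongDual ℝ E} (h : ∀ w, u w = 0 → v w = 0) :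
    ∃ c : ℝ, v = c • u := by
  by_cases hu : u = 0
  · exact ⟨0, by ext w; simpa using h w (by simp [hu])⟩
  obtain ⟨a, ha⟩ : ∃ a, u a ≠ 0 := by
    by_contra! h0
    exact hu (ContinuousLinearMap.ext h0)
  refine ⟨v a / u a, ?_⟩
  ext w
  have h1 := h (w - (u w / u a) • a) (by simp [ha])
  simp only [map_sub, map_smul, smul_eq_mul, sub_eq_zero] at h1
  simp only [_root_.smul_apply, smul_eq_mul, h1]
  field_simp

theorem IsLocalEquation.eventually {H : Set E} {x : E} {g : E → ℝ} (h : IsLocalEquation H x g) :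
    ∀ᶠ y in 𝓝 x, IsLocalEquation H y g := by
  have h1 : ∀ᶠ y in 𝓝 x, fderiv ℝ g y ≠ 0 :=
    (h.contDiffAt.continuousAt_fderiv (by simp)).eventually_ne h.fderiv_ne_zero
  filter_upwards [h.contDiffAt.eventually (by simp), h1, h.mem_iff.eventually_nhds]
    with y h1 h2 h3 using ⟨h1, h2, h3⟩

theorem IsLocalEquation.congr_set {H K : Set E} {x : E} {g : E → ℝ} (h : IsLocalEquation H x g)
    (hHK : ∀ᶠ y in 𝓝 x, y ∈ K ↔ y ∈ H) : IsLocalEquation K x g :=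
  ⟨h.contDiffAt, h.fderiv_ne_zero, by filter_upwards [h.mem_iff, hHK] with y h1 h2 using h2.trans h1⟩

/-- Two local equations of the same hypersurface have the same conormal line. -/
theorem IsLocalEquation.mk_fderiv_eq [CompleteSpace E] {H : Set E} {x : E} {g g' : E → ℝ}
    (h : IsLocalEquation H x g) (h' : IsLocalEquation H x g') (hx : x ∈ H) :
    Projectivization.mk ℝ (fderiv ℝ g x) h.fderiv_ne_zero =
      Projectivization.mk ℝ (fderiv ℝ g' x) h'.fderiv_ne_zero := by
  obtain ⟨c, -, hc⟩ := exists_fderiv_eq_smul h'.contDiffAt h.contDiffAt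
    (h'.mem_iff.self_of_nhds.mp hx) h'.fderiv_ne_zero h.fderiv_ne_zero
    (by filter_upwards [h.mem_iff, h'.mem_iff] with y h1 h2 h3 using h1.mp (h2.mpr h3))
  rw [Projectivization.mk_eq_mk_iff']
  exact ⟨c, hc.symm⟩

theorem IsLocalEquation.isConormal {H : Set E} {x : E} {g : E → ℝ} (h : IsLocalEquation H x g) :
    IsConormal H x (fderiv ℝ g x) := ⟨g, h, fun _ hw => hw⟩

theorem IsConormal.exists_mk_eq {H : Set E} {x : E} {v : StrongDual ℝ E} (h : IsConormal H x v)
    (hv : v ≠ 0) : ∃ (g : E → ℝ) (hg : IsLocalEquation H x g),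
      Projectivization.mk ℝ v hv = Projectivization.mk ℝ (fderiv ℝ g x) hg.fderiv_ne_zero := by
  obtain ⟨g, hg, hker⟩ := h
  refine ⟨g, hg, ?_⟩
  obtain ⟨c, hc⟩ := exists_eq_smul_of_ker_le hker
  rw [Projectivization.mk_eq_mk_iff']
  exact ⟨c, hc.symm⟩

end LocalEquations

/-! ### Hypersurfaces with a global regular equation, and their finite unions -/

section RegularEquations

variable {E : Type*} [NormedAddCommGroup E] [NormedSpace ℝ E]

/-- `g` is a `C^1` function with zero locus `K` and regular along `K`. -/
structure IsRegularEquation (K : Set E) (g : E → ℝ) : Prop where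
  contDiff : ContDiff ℝ 1 g
  mem_iff : ∀ x, x ∈ K ↔ g x = 0
  fderiv_ne_zero : ∀ x ∈ K, fderiv ℝ g x ≠ 0

namespace IsRegularEquation

variable {K : Set E} {g : E → ℝ}

theorem isClosed (h : IsRegularEquation K g) : IsClosed K := by
  have : K = g ⁻¹' {0} := by
    ext x
    exact h.mem_iff x
  rw [this]
  exact isClosed_singleton.preimage h.contDiff.continuous

theorem isLocalEquation (h : IsRegularEquation K g) {x : E} (hx : x ∈ K) :
    IsLocalEquation K x g :=
  ⟨h.contDiff.contDiffAt, h.fderiv_ne_zero x hx, Eventually.of_forall h.mem_iff⟩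

/-- The differential of the equation, as a nonzero covector. -/
def covector (h : IsRegularEquation K g) (x : K) : {v : StrongDual ℝ E // v ≠ 0} :=
  ⟨fderiv ℝ g x, h.fderiv_ne_zero x x.2⟩

theorem continuous_covector (h : IsRegularEquation K g) : Continuous h.covector :=
  ((h.contDiff.continuous_fderiv (by simp)).comp continuous_subtype_val).subtype_mk _

/-- The conormal line at a point of the hypersurface. -/
def line (h : IsRegularEquation K g) (x : K) : CotangentLines E :=
  (x, Projectivization.mk ℝ (h.covector x).1 (h.covector x).2)

/-- The conormal ray of the differential of the equation at a point of the hypersurface. -/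
def ray (h : IsRegularEquation K g) (x : K) : CotangentRays E :=
  (x, rayOfNeZero ℝ (h.covector x).1 (h.covector x).2)

theorem continuous_line (h : IsRegularEquation K g) : Continuous h.line :=
  continuous_subtype_val.prodMk (continuous_projectivizationMk.comp h.continuous_covector)

theorem continuous_ray (h : IsRegularEquation K g) : Continuous h.ray :=
  continuous_subtype_val.prodMk (continuous_rayOfNeZero.comp h.continuous_covector)

theorem lineOfRay_ray (h : IsRegularEquation K g) (x : K) :
    ((h.ray x).1, lineOfRay (h.ray x).2) = h.line x :=
  Prod.ext rfl (lineOfRay_rayOfNeZero _ _)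

/-- The section is the graph of a continuous map from a closed set to a Hausdorff space. -/
theorem isClosedEmbedding_line (h : IsRegularEquation K g) : IsClosedEmbedding h.line := by
  refine ⟨IsEmbedding.of_comp h.continuous_line continuous_fst IsEmbedding.subtypeVal, ?_⟩
  have h1 : IsClosed {q : K × ℙ ℝ (StrongDual ℝ E) | q.2 = (h.line q.1).2} :=
    isClosed_eq continuous_snd (continuous_snd.comp (h.continuous_line.comp continuous_fst))
  have h2 := (h.isClosed.isClosedEmbedding_subtypeVal.prodMap
    (IsClosedEmbedding.id (X := ℙ ℝ (StrongDual ℝ E)))).isClosedMap _ h1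
  convert h2 using 1
  ext ⟨x, l⟩
  constructor
  · rintro ⟨y, hy⟩
    exact ⟨(y, (h.line y).2), rfl, hy⟩
  · rintro ⟨⟨y, m⟩, hm, hy⟩
    refine ⟨y, ?_⟩
    rw [← hy]
    exact Prod.ext rfl hm.symm

theorem pointsTowards_ray (h : IsRegularEquation K g) (x : K) :
    PointsTowards (h.ray x) {y | 0 ≤ g y} := by
  refine ⟨_, (h.covector x).2, rfl, fun w hw => ?_⟩
  have h1 : HasDerivAt (fun t : ℝ => g ((x : E) + t • w)) (fderiv ℝ g x w) 0 := by
    have h2 : HasDerivAt (fun t : ℝ => (x : E) + t • w) w 0 := by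
      simpa using ((hasDerivAt_id (0 : ℝ)).smul_const w).const_add (x : E)
    refine HasFDerivAt.comp_hasDerivAt (l := g) 0 ?_ h2
    simpa using (h.contDiff.differentiable (by simp) (x : E)).hasFDerivAt
  have h3 := (hasDerivAt_iff_tendsto_slope.mp h1).mono_left
    (nhdsWithin_mono 0 (fun t (ht : t ∈ Ioi 0) => ne_of_gt ht))
  filter_upwards [h3.eventually (lt_mem_nhds hw), self_mem_nhdsWithin] with t ht ht0
  have h0 : g x = 0 := (h.mem_iff x).mp x.2
  rw [slope_def_field, zero_smul, add_zero, h0, sub_zero, sub_zero] at ht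
  exact ((div_pos_iff_of_pos_right ht0).mp ht).le

end IsRegularEquation

variable {ι : Type*} {K : ι → Set E} {g : ι → E → ℝ}

theorem mk_eq_line_of_isLocalEquation [CompleteSpace E] {H K : Set E} {g u : E → ℝ}
    (h : IsRegularEquation K g) {x : E} (hx : x ∈ K) (hK : IsLocalEquation H x g) (hxH : x ∈ H)
    (hu : IsLocalEquation H x u) :
    ((x, Projectivization.mk ℝ (fderiv ℝ u x) hu.fderiv_ne_zero) : CotangentLines E) =
      h.line ⟨x, hx⟩ :=
  Prod.ext rfl (hu.mk_fderiv_eq hK hxH)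

/-- A regular hypersurface contained in another one near a point agrees with it near the point. -/
theorem eventually_mem_iff_of_eventually_imp [CompleteSpace E] {K L : Set E} {g u : E → ℝ}
    (hK : IsRegularEquation K g) (hL : IsRegularEquation L u) {x : E} (hx : x ∈ K)
    (himp : ∀ᶠ y in 𝓝 x, y ∈ K → y ∈ L) : ∀ᶠ y in 𝓝 x, y ∈ L → y ∈ K := by
  simp only [hK.mem_iff, hL.mem_iff] at himp ⊢
  have hx0 := (hK.mem_iff x).mp hx
  have hxL : x ∈ L := (hL.mem_iff x).mpr (himp.self_of_nhds hx0)
  obtain ⟨c, hc, hcd⟩ := exists_fderiv_eq_smul hK.contDiff.contDiffAt hL.contDiff.contDiffAt hx0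
    (hK.fderiv_ne_zero x hx) (hL.fderiv_ne_zero x hxL) himp
  obtain ⟨w, hw⟩ : ∃ w, fderiv ℝ g x w ≠ 0 := by
    by_contra! h0
    exact hK.fderiv_ne_zero x hx (ContinuousLinearMap.ext h0)
  refine eventually_zero_of_zero_imp_zero (w := w) hK.contDiff.contDiffAt hL.contDiff.contDiffAt
    hx0 hw ?_ himp
  rw [hcd]
  simpa using ⟨hc, hw⟩

/-- In a finite union of regular hypersurfaces, the points of a member near which the union is
the member are dense in the member. -/
theorem mem_closure_isLocalEquation_iUnion [CompleteSpace E] [Finite ι]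
    (h : ∀ i, IsRegularEquation (K i) (g i)) (i : ι) (x : K i) :
    x ∈ closure {y : K i | IsLocalEquation (⋃ j, K j) (y : E) (g i)} := by
  have := (h i).isClosed.completeSpace_coe
  let F : ι → Set (K i) := fun j => Subtype.val ⁻¹' K j
  have hF : ∀ j, IsClosed (F j) := fun j => (h j).isClosed.preimage continuous_subtype_val
  -- Frontiers of closed sets are nowhere dense. Off all of them, each `K j` either misses the point
  -- or contains `K i` near it, and in the latter case agrees with `K i` there.
  have hdense : Dense (⋂ j, (frontier (F j))ᶜ) := by
    refine dense_iInter_of_isOpen (fun j => isClosed_frontier.isOpen_compl) fun j => ?_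
    rw [← interior_eq_empty_iff_dense_compl]
    exact interior_frontier (hF j)
  refine (closure_mono ?_) (hdense x)
  intro y hy
  rw [mem_iInter] at hy
  refine ((h i).isLocalEquation y.2).congr_set ?_
  have hj : ∀ j, ∀ᶠ z in 𝓝 (y : E), z ∈ K j → z ∈ K i := by
    intro j
    by_cases hyj : (y : E) ∈ K j
    · have hint : y ∈ interior (F j) := by
        by_contra hn
        exact hy j ⟨subset_closure hyj, hn⟩
      have h1 : ∀ᶠ z : K i in 𝓝 y, (z : E) ∈ K j := mem_interior_iff_mem_nhds.mp hint
      rw [nhds_subtype_eq_comap, eventually_comap] at h1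
      refine eventually_mem_iff_of_eventually_imp (h i) (h j) y.2 ?_
      filter_upwards [h1] with z hz hzi using hz ⟨z, hzi⟩ rfl
    · filter_upwards [(h j).isClosed.isOpen_compl.mem_nhds hyj] with z hz hz' using absurd hz' hz
  filter_upwards [eventually_all.mpr hj] with z hz
  rw [mem_iUnion]
  exact ⟨fun ⟨j, hj⟩ => hz j hj, fun hi => ⟨i, hi⟩⟩

theorem mem_closure_of_forall_isLocalEquation_iUnion [CompleteSpace E] [Finite ι]
    (h : ∀ i, IsRegularEquation (K i) (g i)) {Y : Type*} [TopologicalSpace Y] {i : ι}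
    {s : K i → Y} (hs : Continuous s) {S : Set Y}
    (hS : ∀ y : K i, IsLocalEquation (⋃ j, K j) (y : E) (g i) → s y ∈ S) (x : K i) :
    s x ∈ closure S :=
  map_mem_closure hs (mem_closure_isLocalEquation_iUnion h i x) hS

theorem mem_smoothLocus_iUnion {i : ι} {y : K i}
    (hy : IsLocalEquation (⋃ j, K j) (y : E) (g i)) : (y : E) ∈ smoothLocus (⋃ j, K j) :=
  ⟨mem_iUnion_of_mem i y.2, _, hy⟩

theorem line_mem_colineBundle_iUnion [CompleteSpace E] [Finite ι]
    (h : ∀ i, IsRegularEquation (K i) (g i)) (i : ι) (x : K i) :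
    (h i).line x ∈ colineBundle (⋃ j, K j) := by
  unfold colineBundle
  refine mem_closure_of_forall_isLocalEquation_iUnion h (h i).continuous_line ?_ x
  exact fun y hy => ⟨mem_smoothLocus_iUnion hy, _, ((h i).covector y).2, hy.isConormal, rfl⟩

theorem ray_mem_corayBundle_iUnion [CompleteSpace E] [Finite ι]
    (h : ∀ i, IsRegularEquation (K i) (g i)) (i : ι) (x : K i) :
    (h i).ray x ∈ corayBundle (⋃ j, K j) := by
  unfold corayBundle
  refine mem_closure_of_forall_isLocalEquation_iUnion h (h i).continuous_ray ?_ x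
  exact fun y hy => ⟨mem_smoothLocus_iUnion hy, _, ((h i).covector y).2, hy.isConormal, rfl⟩

theorem isClosed_iUnion_range_line [Finite ι] (h : ∀ i, IsRegularEquation (K i) (g i)) :
    IsClosed (⋃ i, range (h i).line) :=
  isClosed_iUnion_of_finite fun i => (h i).isClosedEmbedding_line.isClosed_range

theorem isClosed_iUnion_of_regular [Finite ι] (h : ∀ i, IsRegularEquation (K i) (g i)) :
    IsClosed (⋃ i, K i) := isClosed_iUnion_of_finite fun i => (h i).isClosed

/-- The coline bundle of a finite union of regular hypersurfaces is the union of their conormal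
lines. -/
theorem colineBundle_iUnion [CompleteSpace E] [Finite ι]
    (h : ∀ i, IsRegularEquation (K i) (g i)) :
    colineBundle (⋃ i, K i) = ⋃ i, range (h i).line := by
  refine Subset.antisymm (closure_minimal ?_ (isClosed_iUnion_range_line h)) ?_
  · rintro ⟨x, l⟩ ⟨⟨hx, -⟩, v, hv, hconormal, rfl : l = _⟩
    obtain ⟨u, hu, hvu⟩ := hconormal.exists_mk_eq hv
    rw [hvu]
    have := (isClosed_iUnion_of_regular h).completeSpace_coe
    let F : ι → Set (⋃ i, K i : Set E) := fun j => Subtype.val ⁻¹' K j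
    have hF : ∀ j, IsClosed (F j) := fun j => (h j).isClosed.preimage continuous_subtype_val
    have hcover : ⋃ j, F j = univ := by
      rw [← preimage_iUnion, eq_univ_iff_forall]
      exact fun y => y.2
    -- By Baire, at a dense set of points of the union it coincides locally with a single member.
    -- There the line of `du` is a conormal line of that member; since this line varies continuously
    -- near `x`, it stays in the closed union of sections at `x`.
    have hdense := dense_iUnion_interior_of_closed hF hcover
    have hU : ∀ᶠ y : (⋃ i, K i : Set E) in 𝓝 ⟨x, hx⟩, IsLocalEquation (⋃ i, K i) (y : E) u :=
      (continuous_subtype_val.tendsto (⟨x, hx⟩ : (⋃ i, K i : Set E))).eventually hu.eventually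
    obtain ⟨N, hNsub, hNopen, hxN⟩ := eventually_nhds_iff.mp hU
    let s : N → CotangentLines E := fun y =>
      (y.1.1, Projectivization.mk ℝ (fderiv ℝ u y.1.1) (hNsub y.1 y.2).fderiv_ne_zero)
    have hs : Continuous s := by
      refine (continuous_subtype_val.comp continuous_subtype_val).prodMk ?_
      refine continuous_projectivizationMk.comp (f := fun y : N =>
        ⟨fderiv ℝ u y.1.1, (hNsub y.1 y.2).fderiv_ne_zero⟩) (Continuous.subtype_mk ?_ _)
      rw [continuous_iff_continuousAt]
      intro y
      refine ContinuousAt.comp (g := fderiv ℝ u) (f := fun y : N => y.1.1)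
        ((hNsub y.1 y.2).contDiffAt.continuousAt_fderiv (by simp)) (by fun_prop)
    have hdN : Dense ((Subtype.val : N → _) ⁻¹' (⋃ j, interior (F j))) :=
      hdense.preimage hNopen.isOpenMap_subtype_val
    have := map_mem_closure (t := ⋃ i, range (h i).line) hs (hdN ⟨⟨x, hx⟩, hxN⟩) ?_
    · rwa [(isClosed_iUnion_range_line h).closure_eq] at this
    · rintro ⟨y, hyN⟩ hy
      obtain ⟨j, hj⟩ := mem_iUnion.mp hy
      have hyK : y ∈ F j := interior_subset hj
      refine mem_iUnion_of_mem j ⟨⟨y, hyK⟩, 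
        (mk_eq_line_of_isLocalEquation (h j) hyK ?_ y.2 (hNsub y hyN)).symm⟩
      refine ((h j).isLocalEquation hyK).congr_set ?_
      have h1 : ∀ᶠ z : (⋃ i, K i : Set E) in 𝓝 y, (z : E) ∈ K j := mem_interior_iff_mem_nhds.mp hj
      rw [nhds_subtype_eq_comap, eventually_comap] at h1
      filter_upwards [h1] with z hz
      exact ⟨fun hzU => hz ⟨z, hzU⟩ rfl, fun hzj => mem_iUnion_of_mem j hzj⟩
  · refine iUnion_subset fun i => ?_
    rintro _ ⟨x, rfl⟩
    exact line_mem_colineBundle_iUnion h i x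

theorem exists_line_eq_of_mem_colineBundle [CompleteSpace E] [Finite ι]
    (h : ∀ i, IsRegularEquation (K i) (g i)) {p : CotangentLines E}
    (hp : p ∈ colineBundle (⋃ i, K i)) : ∃ i x, (h i).line x = p := by
  rw [colineBundle_iUnion h] at hp
  simpa using hp

/-- Each member contributes at most one line over a given point, so fibers are finite. The front
image of a closed set is a finite union of closed subsets of the `K i`, and a continuous closed map
with compact fibers is proper. -/
theorem isInGoodPosition_iUnion [CompleteSpace E] [Finite ι]
    (h : ∀ i, IsRegularEquation (K i) (g i)) : IsInGoodPosition (⋃ i, K i) := by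
  have hfin : ∀ x, (front (⋃ i, K i) ⁻¹' {x}).Finite := by
    intro x
    have : (Subtype.val '' (front (⋃ i, K i) ⁻¹' {x})) ⊆
        ⋃ i, {p | ∃ hx : x ∈ K i, (h i).line ⟨x, hx⟩ = p} := by
      rintro _ ⟨p, hp, rfl⟩
      obtain ⟨i, y, hy⟩ := exists_line_eq_of_mem_colineBundle h p.2
      have hyx : y = x := by
        rw [← show front _ p = x from hp, front, ← hy]
        rfl
      subst hyx
      exact mem_iUnion_of_mem i ⟨y.2, hy⟩
    refine Finite.of_finite_image ((finite_iUnion fun i => ?_).subset this)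
      Subtype.val_injective.injOn
    exact Set.Subsingleton.finite fun p ⟨_, hp⟩ q ⟨_, hq⟩ => hp.symm.trans hq
  refine ⟨isClosed_iUnion_of_regular h, ?_, ?_, hfin⟩
  · intro x hx
    obtain ⟨i, hi⟩ := mem_iUnion.mp hx
    exact mem_closure_of_forall_isLocalEquation_iUnion h (s := Subtype.val) (i := i)
      continuous_subtype_val (fun y hy => mem_smoothLocus_iUnion hy) ⟨x, hi⟩
  · rw [isProperMap_iff_isClosedMap_and_compact_fibers]
    refine ⟨continuous_fst.comp continuous_subtype_val, ?_, fun x => (hfin x).isCompact⟩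
    intro C hC
    let s : ∀ i, K i → colineBundle (⋃ i, K i) := fun i x =>
      ⟨(h i).line x, line_mem_colineBundle_iUnion h i x⟩
    have hs : ∀ i, Continuous (s i) := fun i => (h i).continuous_line.subtype_mk _
    have : front (⋃ i, K i) '' C = ⋃ i, Subtype.val '' (s i ⁻¹' C) := by
      ext x
      rw [mem_iUnion]
      constructor
      · rintro ⟨p, hp, rfl⟩
        obtain ⟨i, y, hy⟩ := exists_line_eq_of_mem_colineBundle h p.2
        have hsy : s i y = p := Subtype.ext hy
        exact ⟨i, y, by rwa [mem_preimage, hsy], by rw [← hsy]; rfl⟩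
      · rintro ⟨i, y, hy, rfl⟩
        exact ⟨s i y, hy, rfl⟩
    rw [this]
    exact isClosed_iUnion_of_finite fun i =>
      (h i).isClosed.isClosedEmbedding_subtypeVal.isClosedMap _ (hC.preimage (hs i))

end RegularEquations

/-! ### Coline bundle and coorientation of a single regular hypersurface -/

section SingleEquation

variable {E : Type*} [NormedAddCommGroup E] [NormedSpace ℝ E] [CompleteSpace E]
  {K : Set E} {g : E → ℝ}

namespace IsRegularEquation

theorem colineBundle_eq (h : IsRegularEquation K g) : colineBundle K = range h.line := by
  have := colineBundle_iUnion (ι := Unit) fun _ => h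
  rwa [iUnion_const, iUnion_const] at this

theorem isInGoodPosition (h : IsRegularEquation K g) : IsInGoodPosition K := by
  have := isInGoodPosition_iUnion (ι := Unit) fun _ => h
  rwa [iUnion_const] at this

theorem ray_mem_corayBundle (h : IsRegularEquation K g) (x : K) : h.ray x ∈ corayBundle K := by
  have := ray_mem_corayBundle_iUnion (ι := Unit) (fun _ => h) () x
  rwa [iUnion_const] at this

theorem line_mem_colineBundle (h : IsRegularEquation K g) (x : K) :
    h.line x ∈ colineBundle K := by
  rw [h.colineBundle_eq]
  exact mem_range_self x

theorem front_mem (h : IsRegularEquation K g) (p : colineBundle K) : front K p ∈ K := by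
  obtain ⟨x, hx⟩ := h.colineBundle_eq.subset p.2
  rw [front, ← hx]
  exact x.2

theorem line_front (h : IsRegularEquation K g) (p : colineBundle K) :
    h.line ⟨front K p, h.front_mem p⟩ = p := by
  obtain ⟨x, hx⟩ := h.colineBundle_eq.subset p.2
  rw [← hx]
  congr 1
  refine Subtype.ext (Eq.trans ?_ (congrArg Prod.fst hx).symm)
  rfl

/-- The coorientation given by the differential of the equation. -/
def coorientation (h : IsRegularEquation K g) : Coorientation K where
  toFun p := ⟨h.ray ⟨front K p, h.front_mem p⟩, h.ray_mem_corayBundle _⟩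
  continuous_toFun := (h.continuous_ray.comp
    ((continuous_fst.comp continuous_subtype_val).subtype_mk _)).subtype_mk _
  isSection p := (h.lineOfRay_ray _).trans (h.line_front p)

end IsRegularEquation

end SingleEquation

/-! ### Uniqueness of coorientations and their positive ray bundles -/

section Coorientations

theorem Coorientation.ext_of_toFun {E : Type*} [NormedAddCommGroup E] [NormedSpace ℝ E] {H : Set E}
    {σ τ : Coorientation H} (h : ∀ p, (σ.toFun p).1 = (τ.toFun p).1) : σ = τ := by
  have : σ.toFun = τ.toFun := funext fun p => Subtype.ext (h p)
  cases σ
  cases τ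
  congr

/-- A coorientation of a finite union of regular hypersurfaces is determined by its restrictions
to the members. -/
theorem Coorientation.eq_of_restrictsTo {E ι : Type*} [NormedAddCommGroup E] [NormedSpace ℝ E]
    [CompleteSpace E] [Finite ι] {K : ι → Set E} {g : ι → E → ℝ}
    (h : ∀ i, IsRegularEquation (K i) (g i)) {τ : ∀ i, Coorientation (K i)}
    {σ σ' : Coorientation (⋃ i, K i)} (hσ : ∀ i, σ.RestrictsTo (τ i))
    (hσ' : ∀ i, σ'.RestrictsTo (τ i)) : σ' = σ := by
  refine Coorientation.ext_of_toFun fun p => ?_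
  obtain ⟨i, x, hx⟩ := exists_line_eq_of_mem_colineBundle h p.2
  obtain ⟨_, h1⟩ := hσ i ⟨p.1, hx ▸ (h i).line_mem_colineBundle x⟩
  obtain ⟨_, h2⟩ := hσ' i ⟨p.1, hx ▸ (h i).line_mem_colineBundle x⟩
  exact h2.trans h1.symm

/-- A coorientation is a homeomorphism onto its positive ray bundle. -/
def Coorientation.homeoPositiveRayBundle {E : Type*} [NormedAddCommGroup E] [NormedSpace ℝ E]
    {H : Set E} (σ : Coorientation H) : colineBundle H ≃ₜ σ.positiveRayBundle where
  toFun p := ⟨(σ.toFun p).1, p, rfl⟩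
  invFun r := ⟨(r.1.1, lineOfRay r.1.2), by
    obtain ⟨_, p, rfl⟩ := r
    rw [σ.isSection]
    exact p.2⟩
  left_inv p := Subtype.ext (σ.isSection p)
  right_inv := by
    rintro ⟨_, p, rfl⟩
    refine Subtype.ext ?_
    simp only
    congr 2
    exact Subtype.ext (σ.isSection p)
  continuous_toFun := (continuous_subtype_val.comp σ.continuous_toFun).subtype_mk _
  continuous_invFun := ((continuous_fst.comp continuous_subtype_val).prodMk
    (continuous_lineOfRay.comp (continuous_snd.comp continuous_subtype_val))).subtype_mk _

end Coorientations

/-! ### The smoothing function along its zero locus -/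

section Smoothing

variable {b : ℝ → ℝ} {f : ℝ × ℝ → ℝ}

theorem fderiv_prod_apply (f : ℝ × ℝ → ℝ) (p : ℝ × ℝ) (u v : ℝ) :
    fderiv ℝ f p (u, v) = u * fderiv ℝ f p (1, 0) + v * fderiv ℝ f p (0, 1) := by
  have : ((u, v) : ℝ × ℝ) = u • (1, 0) + v • (0, 1) := by simp
  rw [this, map_add, map_smul, map_smul, smul_eq_mul, smul_eq_mul]

/-- A function vanishing at a point and nonnegative to its right has nonnegative derivative. -/
theorem nonneg_of_hasDerivAt {u : ℝ → ℝ} {u' x : ℝ} (h : HasDerivAt u u' x) (hx : u x = 0)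
    (hnonneg : ∀ y, x < y → 0 ≤ u y) : 0 ≤ u' := by
  refine ge_of_tendsto ((hasDerivAt_iff_tendsto_slope.mp h).mono_left
    (nhdsWithin_mono x (fun t (ht : t ∈ Ioi x) => ne_of_gt ht))) ?_
  filter_upwards [self_mem_nhdsWithin] with y hy
  rw [slope_def_field, hx, sub_zero]
  exact div_nonneg (hnonneg y hy) (sub_pos.mpr hy).le

namespace IsSmoothing

theorem hasFDerivAt (hf : IsSmoothing b f) (p : ℝ × ℝ) : HasFDerivAt f (fderiv ℝ f p) p :=
  (hf.contDiff.differentiable (by simp) p).hasFDerivAt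

theorem hasDerivAt_fst (hf : IsSmoothing b f) (s t : ℝ) :
    HasDerivAt (fun s' => f (s', t)) (fderiv ℝ f (s, t) (1, 0)) s :=
  (hf.hasFDerivAt (s, t)).comp_hasDerivAt s ((hasDerivAt_id s).prodMk (hasDerivAt_const s t))

theorem hasDerivAt_snd (hf : IsSmoothing b f) (s t : ℝ) :
    HasDerivAt (fun t' => f (s, t')) (fderiv ℝ f (s, t) (0, 1)) t :=
  (hf.hasFDerivAt (s, t)).comp_hasDerivAt t ((hasDerivAt_const t s).prodMk (hasDerivAt_id t))

theorem partials_ne_zero (hf : IsSmoothing b f) (p : ℝ × ℝ) :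
    ¬ (fderiv ℝ f p (1, 0) = 0 ∧ fderiv ℝ f p (0, 1) = 0) := by
  rintro ⟨h1, h2⟩
  obtain ⟨⟨u, v⟩, h⟩ := hf.submersion p 1
  rw [fderiv_prod_apply, h1, h2] at h
  simp at h

/-- `f` vanishes on the whole vertical ray; the right derivative suffices, which also covers the
endpoint `t = 0`. -/
theorem snd_partial_eq_zero (hf : IsSmoothing b f) {t : ℝ} (ht : 0 ≤ t) :
    fderiv ℝ f (0, t) (0, 1) = 0 := by
  have h1 := (hf.hasDerivAt_snd 0 t).hasDerivWithinAt (s := Ici t)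
  have h2 : HasDerivWithinAt (fun t' => f (0, t')) 0 (Ici t) t := by
    refine (hasDerivWithinAt_const t (Ici t) (0 : ℝ)).congr_of_mem (fun y hy => ?_) self_mem_Ici
    exact (hf.eq_zero_iff 0 y).mpr (Or.inl ⟨rfl, ht.trans hy⟩)
  exact (uniqueDiffWithinAt_Ici t).eq_deriv _ h1 h2

/-- Since `b ≤ 0`, `f` is nonnegative to the right of the ray, so this partial is nonnegative; it
cannot vanish because the other partial does. -/
theorem fst_partial_pos (hb : IsProfile b) (hf : IsSmoothing b f) {t : ℝ} (ht : 0 ≤ t) :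
    0 < fderiv ℝ f (0, t) (1, 0) := by
  have h1 : 0 ≤ fderiv ℝ f (0, t) (1, 0) := by
    refine nonneg_of_hasDerivAt (hf.hasDerivAt_fst 0 t)
      ((hf.eq_zero_iff 0 t).mpr (Or.inl ⟨rfl, ht⟩)) fun s hs => ?_
    by_contra! hneg
    have := hb.nonpos s hs
    rcases (hf.neg_iff s t).mp hneg with h | ⟨h, -⟩ | ⟨-, h⟩ <;> linarith
  refine h1.lt_of_ne fun h0 => hf.partials_ne_zero (0, t) ⟨h0.symm, hf.snd_partial_eq_zero ht⟩

/-- If this partial vanished, differentiating `f (s, b s) = 0` would make the other one vanish too.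
-/
theorem snd_partial_pos (hb : IsProfile b) (hf : IsSmoothing b f) {s : ℝ} (hs : 0 < s) :
    0 < fderiv ℝ f (s, b s) (0, 1) := by
  have hzero : ∀ s, 0 < s → f (s, b s) = 0 := fun s hs =>
    (hf.eq_zero_iff s (b s)).mpr (Or.inr ⟨hs, rfl⟩)
  have h1 : 0 ≤ fderiv ℝ f (s, b s) (0, 1) :=
    nonneg_of_hasDerivAt (hf.hasDerivAt_snd s (b s)) (hzero s hs)
      fun t ht => ((hf.pos_iff s t).mpr ⟨hs, ht⟩).le
  refine h1.lt_of_ne fun h0 => hf.partials_ne_zero (s, b s) ⟨?_, h0.symm⟩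
  have hbd : HasDerivAt b (deriv b s) s :=
    ((hb.contDiffOn.contDiffAt (Ioi_mem_nhds hs)).differentiableAt (by simp)).hasDerivAt
  have h2 : HasDerivAt (fun s' => f (s', b s')) (fderiv ℝ f (s, b s) (1, deriv b s)) s :=
    HasFDerivAt.comp_hasDerivAt (l := f) s (hf.hasFDerivAt (s, b s)) ((hasDerivAt_id s).prodMk hbd)
  have h3 : HasDerivAt (fun s' => f (s', b s')) 0 s := by
    refine (hasDerivAt_const s (0 : ℝ)).congr_of_eventuallyEq ?_
    filter_upwards [Ioi_mem_nhds hs] with s' hs' using hzero s' hs'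
  have h4 := h2.unique h3
  rw [fderiv_prod_apply, ← h0] at h4
  simpa using h4

end IsSmoothing

/-- The continuous extension by zero of a profile. -/
def extendProfile (b : ℝ → ℝ) (s : ℝ) : ℝ := if 0 < s then b s else 0

theorem extendProfile_of_pos (b : ℝ → ℝ) {s : ℝ} (hs : 0 < s) : extendProfile b s = b s :=
  if_pos hs

theorem extendProfile_zero (b : ℝ → ℝ) : extendProfile b 0 = 0 := if_neg (lt_irrefl 0)

theorem IsProfile.continuous_extendProfile (hb : IsProfile b) : Continuous (extendProfile b) := by
  rw [continuous_iff_continuousAt]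
  intro s
  rcases lt_trichotomy s 0 with hs | rfl | hs
  · refine (continuousAt_const (y := (0 : ℝ))).congr ?_
    filter_upwards [Iio_mem_nhds hs] with t ht
    exact (if_neg (not_lt.mpr (le_of_lt ht))).symm
  · rw [continuousAt_iff_continuous_left'_right', ContinuousWithinAt, ContinuousWithinAt,
      extendProfile_zero]
    constructor
    · refine (tendsto_const_nhds (x := (0 : ℝ))).congr' ?_
      filter_upwards [self_mem_nhdsWithin] with t ht
      exact (if_neg (not_lt.mpr (le_of_lt ht))).symm
    · refine hb.tendsto_zero.congr' ?_
      filter_upwards [self_mem_nhdsWithin] with t ht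
      exact (if_pos ht).symm
  · refine ((hb.contDiffOn.continuousOn.continuousAt (Ioi_mem_nhds hs))).congr ?_
    filter_upwards [Ioi_mem_nhds hs] with t ht
    exact (if_pos ht).symm

end Smoothing

/-! ### Heights on a rooted tree -/

section Heights

variable {V : Type*} {T : SimpleGraph V} {ρ : V}

theorem isParent_or_isParent_of_adj (hT : T.IsTree) {α β : V} (h : T.Adj α β) :
    IsParent T ρ α β ∨ IsParent T ρ β α :=
  (hT.dist_ne_of_adj ρ h).lt_or_gt.imp (fun h' => ⟨h, h'⟩) fun h' => ⟨h.symm, h'⟩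

theorem IsParent.ne {α β : V} (h : IsParent T ρ β α) : β ≠ α := h.1.ne

/-- A geodesic from `ρ` to `β` is too short to meet `α`, so by acyclicity the path to `α` passes
through `β`. Hence parents are unique and the choice made in `height` is immaterial. -/
theorem IsParent.eq_penultimate (hT : T.IsTree) {α β : V} (h : IsParent T ρ β α)
    {q : T.Walk ρ α} (hq : q.IsPath) : β = q.penultimate := by
  classical
  obtain ⟨p, hp, hlen⟩ := hT.connected.exists_path_of_dist ρ β
  refine hT.isAcyclic.eq_penultimate_of_adj_end hq h.1.symm ?_
  refine hT.isAcyclic.mem_support_of_ne_mem_support_of_adj_of_isPath hq hp h.1.symm fun hα => ?_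
  have h1 := T.dist_le (p.takeUntil α hα)
  have h2 := p.length_takeUntil_le_length hα
  have h3 := h.2
  omega

theorem IsParent.unique (hT : T.IsTree) {α β β' : V} (h : IsParent T ρ β α)
    (h' : IsParent T ρ β' α) : β = β' := by
  obtain ⟨q, hq, -⟩ := hT.connected.exists_path_of_dist ρ α
  rw [h.eq_penultimate hT hq, h'.eq_penultimate hT hq]

/-- Induction from the vertices without parent down the tree. -/
theorem parent_induction {P : V → Prop} (root : ∀ α, (¬ ∃ β, IsParent T ρ β α) → P α)
    (step : ∀ α β, IsParent T ρ β α → P β → P α) (α : V) : P α := by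
  induction hn : T.dist ρ α using Nat.strong_induction_on generalizing α with
  | _ n ih =>
    by_cases h : ∃ β, IsParent T ρ β α
    · obtain ⟨β, hβ⟩ := h
      exact step α β hβ (ih _ (hn ▸ hβ.2) β rfl)
    · exact root α h

theorem height_of_not_exists (f : ℝ × ℝ → ℝ) {α : V} (h : ¬ ∃ β, IsParent T ρ β α) (x : V → ℝ) :
    height T ρ f α x = x α := by
  rw [height, dif_neg h]

theorem height_of_isParent (hT : T.IsTree) (f : ℝ × ℝ → ℝ) {α β : V} (h : IsParent T ρ β α)
    (x : V → ℝ) : height T ρ f α x = f (height T ρ f β x, x α) := by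
  have hex : ∃ β, IsParent T ρ β α := ⟨β, h⟩
  rw [height, dif_pos hex, hex.choose_spec.unique hT h]

/-- The height at `α` depends only on `x_α` and on the coordinates at vertices nearer to the root. -/
theorem height_congr (hT : T.IsTree) (f : ℝ × ℝ → ℝ) (α : V) {x y : V → ℝ}
    (h : ∀ δ, (δ = α ∨ T.dist ρ δ < T.dist ρ α) → x δ = y δ) :
    height T ρ f α x = height T ρ f α y := by
  induction α using parent_induction (T := T) (ρ := ρ) with
  | root α hα => rw [height_of_not_exists f hα, height_of_not_exists f hα, h α (Or.inl rfl)]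
  | step α β hβ ih =>
    rw [height_of_isParent hT f hβ, height_of_isParent hT f hβ, h α (Or.inl rfl), ih]
    rintro δ (rfl | hδ)
    · exact h _ (Or.inr hβ.2)
    · exact h _ (Or.inr (hδ.trans hβ.2))

variable {b : ℝ → ℝ} {f : ℝ × ℝ → ℝ}

theorem fderiv_height_of_not_exists {α : V} (h : ¬ ∃ β, IsParent T ρ β α) (x w : V → ℝ) :
    fderiv ℝ (height T ρ f α) x w = w α := by
  rw [show height T ρ f α = ContinuousLinearMap.proj (R := ℝ) (φ := fun _ : V => ℝ) α from
    funext (height_of_not_exists f h), ContinuousLinearMap.fderiv]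
  rfl

variable [Fintype V]

theorem contDiff_height (hT : T.IsTree) (hf : ContDiff ℝ 1 f) (α : V) :
    ContDiff ℝ 1 (height T ρ f α) := by
  induction α using parent_induction (T := T) (ρ := ρ) with
  | root α hα =>
    rw [show height T ρ f α = fun x => x α from funext (height_of_not_exists f hα)]
    exact contDiff_apply ℝ ℝ α
  | step α β hβ ih =>
    rw [show height T ρ f α = fun x => f (height T ρ f β x, x α) from
      funext (height_of_isParent hT f hβ)]
    exact hf.comp (ih.prodMk (contDiff_apply ℝ ℝ α))

theorem hasFDerivAt_height (hT : T.IsTree) (hf : ContDiff ℝ 1 f) (α : V) (x : V → ℝ) :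
    HasFDerivAt (height T ρ f α) (fderiv ℝ (height T ρ f α) x) x :=
  ((contDiff_height hT hf α).differentiable (by simp) x).hasFDerivAt

theorem fderiv_height_of_isParent (hT : T.IsTree) (hf : ContDiff ℝ 1 f) {α β : V}
    (h : IsParent T ρ β α) (x w : V → ℝ) :
    fderiv ℝ (height T ρ f α) x w =
      fderiv ℝ (height T ρ f β) x w * fderiv ℝ f (height T ρ f β x, x α) (1, 0) +
        w α * fderiv ℝ f (height T ρ f β x, x α) (0, 1) := by
  have h1 : HasFDerivAt (fun x => (height T ρ f β x, x α)) ((fderiv ℝ (height T ρ f β) x).prod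
      (ContinuousLinearMap.proj (R := ℝ) (φ := fun _ : V => ℝ) α)) x :=
    (hasFDerivAt_height hT hf β x).prodMk (hasFDerivAt_apply α x)
  have h2 := ((hf.differentiable (by simp) (height T ρ f β x, x α)).hasFDerivAt).comp x h1
  rw [show height T ρ f α = f ∘ fun x => (height T ρ f β x, x α) from
    funext (height_of_isParent hT f h), h2.fderiv, ← fderiv_prod_apply]
  rfl

open Classical in
-- `h_α` involves only the coordinates at `α` and its ancestors, which are nearer to the root.
theorem fderiv_height_single_eq_zero (hT : T.IsTree) (hf : ContDiff ℝ 1 f) {α δ : V}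
    (hne : δ ≠ α) (hδ : T.dist ρ α ≤ T.dist ρ δ) (x : V → ℝ) :
    fderiv ℝ (height T ρ f α) x (Pi.single δ 1) = 0 := by
  induction α using parent_induction (T := T) (ρ := ρ) with
  | root α hα => rw [fderiv_height_of_not_exists hα, Pi.single_eq_of_ne hne.symm]
  | step α β hβ ih =>
    have hlt := hβ.2.trans_le hδ
    rw [fderiv_height_of_isParent hT hf hβ, Pi.single_eq_of_ne hne.symm, ih ?_ hlt.le]
    · simp
    · rintro rfl
      exact lt_irrefl _ hlt

/-- The point lies over the vertical ray of `{f = 0}`, where only the first partial of `f` survives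
and is positive. -/
theorem fderiv_height_of_parent_height_eq_zero (hT : T.IsTree) (hb : IsProfile b)
    (hf : IsSmoothing b f) {α β : V} (h : IsParent T ρ β α) {x : V → ℝ}
    (hα : height T ρ f α x = 0) (hβ : height T ρ f β x = 0) :
    ∃ c : ℝ, 0 < c ∧
      fderiv ℝ (height T ρ f α) x = c • fderiv ℝ (height T ρ f β) x := by
  rw [height_of_isParent hT f h, hβ] at hα
  have hx : 0 ≤ x α := by
    rcases (hf.eq_zero_iff _ _).mp hα with h | h
    · exact h.2
    · exact absurd h.1 (lt_irrefl 0)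
  refine ⟨_, hf.fst_partial_pos hb hx, ?_⟩
  ext w
  rw [fderiv_height_of_isParent hT hf.contDiff h, hβ, hf.snd_partial_eq_zero hx]
  simp [mul_comm]

open Classical in
theorem fderiv_height_single_pos (hT : T.IsTree) (hb : IsProfile b)
    (hf : IsSmoothing b f) {α β : V} (h : IsParent T ρ β α) {x : V → ℝ}
    (hα : height T ρ f α x = 0) (hβ : height T ρ f β x ≠ 0) :
    0 < fderiv ℝ (height T ρ f α) x (Pi.single α 1) := by
  rw [height_of_isParent hT f h] at hα
  rcases (hf.eq_zero_iff _ _).mp hα with h' | h'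
  · exact absurd h'.1 hβ
  · rw [fderiv_height_of_isParent hT hf.contDiff h,
      fderiv_height_single_eq_zero hT hf.contDiff h.ne.symm h.2.le, h'.2]
    simpa using hf.snd_partial_pos hb h'.1

theorem isRegularEquation_height (hT : T.IsTree) (hb : IsProfile b) (hf : IsSmoothing b f)
    (α : V) : IsRegularEquation (vertexHypersurface T ρ f α) (height T ρ f α) where
  contDiff := contDiff_height hT hf.contDiff α
  mem_iff _ := Iff.rfl
  fderiv_ne_zero x hx := by
    classical
    change height T ρ f α x = 0 at hx
    induction α using parent_induction (T := T) (ρ := ρ) with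
    | root α hα =>
      intro h
      have := fderiv_height_of_not_exists (f := f) hα x (Pi.single α 1)
      simp [h] at this
    | step α β hβ ih =>
      by_cases h0 : height T ρ f β x = 0
      · obtain ⟨c, hc, hcd⟩ := fderiv_height_of_parent_height_eq_zero hT hb hf hβ hx h0
        rw [hcd]
        exact smul_ne_zero hc.ne' (ih h0)
      · intro h
        have := fderiv_height_single_pos hT hb hf hβ hx h0
        simp [h] at this

end Heights

/-! ### Charts straightening the hypersurfaces `H_α` -/

section Charts

open Classical in
/-- The piecewise linear homeomorphism `(x_β, x_α) ↦ (x_α + x_β⁻, x_α + x_β⁺)`, carrying the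
halfspace `x_α ≥ 0` to the quadrant `x_α, x_β ≥ 0`. -/
def fold {V : Type*} {β α : V} (h : β ≠ α) : (V → ℝ) ≃ₜ (V → ℝ) where
  toFun x := Function.update (Function.update x β (x α + max (-x β) 0)) α (x α + max (x β) 0)
  invFun y := Function.update (Function.update y β (y α - y β)) α (min (y α) (y β))
  left_inv x := by
    ext γ
    by_cases hα : γ = α
    · subst hα
      rcases le_total (x β) 0 with h0 | h0 <;> simp [h, h0]
    · by_cases hβ : γ = β
      · subst hβ
        rcases le_total (x γ) 0 with h0 | h0 <;> simp [h, h0]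
      · simp [hα, hβ]
  right_inv y := by
    ext γ
    by_cases hα : γ = α
    · subst hα
      rcases le_total (y γ) (y β) with h0 | h0 <;> simp [h, h0]
    · by_cases hβ : γ = β
      · subst hβ
        rcases le_total (y γ) (y α) with h0 | h0 <;> simp [h, h0]
      · simp [hα, hβ]
  continuous_toFun := by fun_prop
  continuous_invFun := by fun_prop

section FoldApply

variable {V : Type*} {β α : V}

theorem fold_apply_left (h : β ≠ α) (x : V → ℝ) : fold h x β = x α + max (-x β) 0 := by
  simp [fold, h]

theorem fold_apply_right (h : β ≠ α) (x : V → ℝ) : fold h x α = x α + max (x β) 0 := by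
  simp [fold]

theorem fold_apply_of_ne (h : β ≠ α) (x : V → ℝ) {γ : V} (hβ : γ ≠ β) (hα : γ ≠ α) :
    fold h x γ = x γ := by
  simp [fold, hα, hβ]

end FoldApply

open Classical in
/-- The shear adding `u` to the coordinate `x_α`. -/
def shear {V : Type*} (α : V) (u : (V → ℝ) → ℝ) (hu : Continuous u)
    (hα : ∀ x t, u (Function.update x α t) = u x) : (V → ℝ) ≃ₜ (V → ℝ) where
  toFun x := Function.update x α (x α + u x)
  invFun x := Function.update x α (x α - u x)
  left_inv x := by simp [hα]
  right_inv x := by simp [hα]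
  continuous_toFun := by fun_prop
  continuous_invFun := by fun_prop

theorem continuous_height {V : Type*} {T : SimpleGraph V} {ρ : V} (hT : T.IsTree)
    {f : ℝ × ℝ → ℝ} (hf : Continuous f) (α : V) : Continuous (height T ρ f α) := by
  induction α using parent_induction (T := T) (ρ := ρ) with
  | root α hα =>
    rw [show height T ρ f α = fun x => x α from funext (height_of_not_exists f hα)]
    exact continuous_apply α
  | step α β hβ ih =>
    rw [show height T ρ f α = fun x => f (height T ρ f β x, x α) from
      funext (height_of_isParent hT f hβ)]
    exact hf.comp (ih.prodMk (continuous_apply α))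

variable {V : Type*} {T : SimpleGraph V} {ρ : V} {b : ℝ → ℝ} {f : ℝ × ℝ → ℝ}

open Classical in
theorem height_update_of_isParent (hT : T.IsTree) (f : ℝ × ℝ → ℝ) {α β : V}
    (h : IsParent T ρ β α) (x : V → ℝ) (t : ℝ) :
    height T ρ f β (Function.update x α t) = height T ρ f β x := by
  refine height_congr hT f β ?_
  rintro δ (rfl | hδ)
  · rw [Function.update_of_ne h.ne]
  · rw [Function.update_of_ne]
    rintro rfl
    exact lt_asymm hδ h.2

/-- The shear by the profile of the height of the parent. -/
def heightShear (hT : T.IsTree) (hb : IsProfile b) (hf : IsSmoothing b f) {α β : V}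
    (h : IsParent T ρ β α) : (V → ℝ) ≃ₜ (V → ℝ) :=
  shear α (fun x => extendProfile b (height T ρ f β x))
    (hb.continuous_extendProfile.comp (continuous_height hT hf.contDiff.continuous β))
    fun x t => by rw [height_update_of_isParent hT f h]

theorem heightShear_apply_self (hT : T.IsTree) (hb : IsProfile b) (hf : IsSmoothing b f) {α β : V}
    (h : IsParent T ρ β α) (x : V → ℝ) :
    heightShear hT hb hf h x α = x α + extendProfile b (height T ρ f β x) := by
  simp [heightShear, shear]

theorem heightShear_apply_of_ne (hT : T.IsTree) (hb : IsProfile b) (hf : IsSmoothing b f)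
    {α β : V} (h : IsParent T ρ β α) (x : V → ℝ) {γ : V} (hγ : γ ≠ α) :
    heightShear hT hb hf h x γ = x γ := by
  simp [heightShear, shear, hγ]

theorem height_heightShear (hT : T.IsTree) (hb : IsProfile b) (hf : IsSmoothing b f)
    {α β : V} (h : IsParent T ρ β α) (x : V → ℝ) :
    height T ρ f β (heightShear hT hb hf h x) = height T ρ f β x :=
  height_update_of_isParent hT f h _ _

theorem heightShear_eq_self (hT : T.IsTree) (hb : IsProfile b) (hf : IsSmoothing b f)
    {α β : V} (h : IsParent T ρ β α) {x : V → ℝ} (hx : height T ρ f β x = 0) :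
    heightShear hT hb hf h x = x := by
  ext γ
  by_cases hγ : γ = α
  · rw [hγ, heightShear_apply_self, hx, extendProfile_zero, add_zero]
  · rw [heightShear_apply_of_ne _ _ _ _ _ hγ]

open Classical in
/-- A homeomorphism of `ℝ^V` carrying the coordinate halfspace `x_α ≥ 0` to `Q_α`. -/
def chart (ρ : V) (hT : T.IsTree) (hb : IsProfile b) (hf : IsSmoothing b f) (α : V) :
    (V → ℝ) ≃ₜ (V → ℝ) :=
  if h : ∃ β, IsParent T ρ β α then
    (fold h.choose_spec.ne).trans
      ((chart ρ hT hb hf h.choose).trans (heightShear hT hb hf h.choose_spec))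
  else Homeomorph.refl _
termination_by T.dist ρ α
decreasing_by exact h.choose_spec.2

/-- Together with `neg_iff_add`: after the shear by the profile, `f` has the sign of the minimum of
its two arguments. -/
theorem IsSmoothing.eq_zero_iff_add (hf : IsSmoothing b f) (s u : ℝ) :
    f (s, u + extendProfile b s) = 0 ↔ min s u = 0 := by
  rw [hf.eq_zero_iff]
  rcases lt_trichotomy s 0 with hs | rfl | hs
  · simp only [hs.ne, hs.not_gt, false_and, or_self, false_iff]
    exact ((min_le_left s u).trans_lt hs).ne
  · simp [extendProfile_zero]
  · rw [extendProfile_of_pos b hs]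
    simp only [hs.ne', hs, false_and, true_and, false_or, add_eq_right]
    constructor
    · rintro rfl
      exact min_eq_right hs.le
    · intro h
      rcases min_choice s u with h' | h'
      · exact absurd (h'.symm.trans h) hs.ne'
      · exact h'.symm.trans h

theorem IsSmoothing.neg_iff_add (hf : IsSmoothing b f) (s u : ℝ) :
    f (s, u + extendProfile b s) < 0 ↔ min s u < 0 := by
  rw [hf.neg_iff]
  rcases lt_trichotomy s 0 with hs | rfl | hs
  · simp [hs]
  · simp [extendProfile_zero]
  · rw [extendProfile_of_pos b hs]
    simp [hs, hs.ne', hs.not_gt]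

variable (hT : T.IsTree) (hb : IsProfile b) (hf : IsSmoothing b f)

theorem chart_of_not_exists {α : V} (h : ¬ ∃ β, IsParent T ρ β α) (x : V → ℝ) :
    chart ρ hT hb hf α x = x := by
  rw [chart, dif_neg h]
  rfl

theorem chart_of_isParent {α β : V} (h : IsParent T ρ β α) (x : V → ℝ) :
    chart ρ hT hb hf α x =
      heightShear hT hb hf h (chart ρ hT hb hf β (fold h.ne x)) := by
  have hex : ∃ β, IsParent T ρ β α := ⟨β, h⟩
  obtain rfl : hex.choose = β := hex.choose_spec.unique hT h
  rw [chart, dif_pos hex]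
  rfl

theorem chart_apply_of_le {α δ : V} (hne : δ ≠ α) (hδ : T.dist ρ α ≤ T.dist ρ δ) (x : V → ℝ) :
    chart ρ hT hb hf α x δ = x δ := by
  induction α using parent_induction (T := T) (ρ := ρ) generalizing x with
  | root α hα => rw [chart_of_not_exists _ _ _ hα]
  | step α β hβ ih =>
    have hlt := hβ.2.trans_le hδ
    have hne' : δ ≠ β := by
      rintro rfl
      exact lt_irrefl _ hlt
    rw [chart_of_isParent _ _ _ hβ, heightShear_apply_of_ne _ _ _ _ _ hne, ih hne' hlt.le,
      fold_apply_of_ne _ _ hne' hne]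

/-- The pair `(h_β, x_α)` in the chart of a child `α` of `β`. -/
theorem height_parent_chart {α β : V} (h : IsParent T ρ β α) (x : V → ℝ) :
    height T ρ f β (chart ρ hT hb hf α x) =
      height T ρ f β (chart ρ hT hb hf β (fold h.ne x)) := by
  rw [chart_of_isParent _ _ _ h, height_heightShear]

theorem chart_apply_self {α β : V} (h : IsParent T ρ β α) (x : V → ℝ) :
    chart ρ hT hb hf α x α = fold h.ne x α +
      extendProfile b (height T ρ f β (chart ρ hT hb hf β (fold h.ne x))) := by
  rw [chart_of_isParent _ _ _ h, heightShear_apply_self,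
    chart_apply_of_le _ _ _ h.ne.symm h.2.le]

theorem min_fold {V : Type*} {α β : V} (h : β ≠ α) (x : V → ℝ) :
    min (fold h x β) (fold h x α) = x α := by
  rw [fold_apply_left, fold_apply_right]
  rcases le_total (x β) 0 with h0 | h0 <;> simp [h0]

/-- The folded coordinates at `β` and `α` have minimum `x_α`, and inductively `h_β` has the sign of
the folded coordinate at `β`. Negativity is carried along because whether a minimum vanishes depends
on the signs of both entries. -/
theorem height_chart_neg_and_eq_zero_iff (α : V) (x : V → ℝ) :
    (height T ρ f α (chart ρ hT hb hf α x) < 0 ↔ x α < 0) ∧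
      (height T ρ f α (chart ρ hT hb hf α x) = 0 ↔ x α = 0) := by
  induction α using parent_induction (T := T) (ρ := ρ) generalizing x with
  | root α hα =>
    rw [chart_of_not_exists _ _ _ hα, height_of_not_exists f hα]
    exact ⟨Iff.rfl, Iff.rfl⟩
  | step α β hβ ih =>
    obtain ⟨h1, h2⟩ := ih (fold hβ.ne x)
    rw [height_of_isParent hT f hβ, chart_apply_self _ _ _ hβ, height_parent_chart _ _ _ hβ,
      hf.eq_zero_iff_add, hf.neg_iff_add, ← min_fold hβ.ne x]
    generalize height T ρ f β (chart ρ hT hb hf β (fold hβ.ne x)) = s at h1 h2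
    generalize fold hβ.ne x β = a at h1 h2
    generalize fold hβ.ne x α = u
    refine ⟨by simp only [min_lt_iff, h1], ?_⟩
    grind

theorem height_chart_eq_zero_iff (α : V) (x : V → ℝ) :
    height T ρ f α (chart ρ hT hb hf α x) = 0 ↔ x α = 0 :=
  (height_chart_neg_and_eq_zero_iff hT hb hf α x).2

end Charts

/-! ### Parametrizing the hypersurfaces by Euclidean pieces -/

section Parametrization

variable {V : Type*}

open Classical in
/-- The inclusion of a piece as a coordinate hyperplane. -/
def Piece.extend {α : V} (x : Piece α) (γ : V) : ℝ := if h : γ = α then 0 else x ⟨γ, h⟩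

theorem Piece.extend_self {α : V} (x : Piece α) : x.extend α = 0 := dif_pos rfl

theorem Piece.extend_of_ne {α γ : V} (x : Piece α) (h : γ ≠ α) : x.extend γ = x ⟨γ, h⟩ :=
  dif_neg h

theorem Piece.continuous_extend {α : V} : Continuous (Piece.extend (α := α)) := by
  refine continuous_pi fun γ => ?_
  by_cases h : γ = α
  · subst h
    simp only [Piece.extend_self]
    exact continuous_const
  · simp only [Piece.extend_of_ne _ h]
    fun_prop

/-- The restriction of a point of `ℝ^V` to a piece. -/
def Piece.restrict (α : V) (x : V → ℝ) : Piece α := fun γ => x γ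

theorem Piece.restrict_extend {α : V} (x : Piece α) : Piece.restrict α x.extend = x :=
  funext fun γ => x.extend_of_ne γ.2

theorem Piece.extend_restrict {α : V} {x : V → ℝ} (h : x α = 0) :
    (Piece.restrict α x).extend = x := by
  ext γ
  by_cases hγ : γ = α
  · subst hγ
    rw [Piece.extend_self, h]
  · rw [Piece.extend_of_ne _ hγ]
    rfl

variable {T : SimpleGraph V} {ρ : V} {b : ℝ → ℝ} {f : ℝ × ℝ → ℝ}
variable (hT : T.IsTree) (hb : IsProfile b) (hf : IsSmoothing b f)

theorem chart_symm_apply_self {α : V} (x : vertexHypersurface T ρ f α) :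
    (chart ρ hT hb hf α).symm x α = 0 := by
  rw [← height_chart_eq_zero_iff hT hb hf, Homeomorph.apply_symm_apply]
  exact x.2

/-- The homeomorphism from the piece of `α` to `H_α`. -/
def pieceHomeo (ρ : V) (α : V) : Piece α ≃ₜ vertexHypersurface T ρ f α where
  toFun x := ⟨chart ρ hT hb hf α x.extend,
    (height_chart_eq_zero_iff hT hb hf α _).mpr x.extend_self⟩
  invFun x := Piece.restrict α ((chart ρ hT hb hf α).symm x)
  left_inv x := by
    simp only [Homeomorph.symm_apply_apply, Piece.restrict_extend]
  right_inv x := by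
    ext1
    simp only
    rw [Piece.extend_restrict (chart_symm_apply_self hT hb hf x), Homeomorph.apply_symm_apply]
  continuous_toFun := ((chart ρ hT hb hf α).continuous.comp Piece.continuous_extend).subtype_mk _
  continuous_invFun := continuous_pi fun γ => (continuous_apply (γ : V)).comp
    ((chart ρ hT hb hf α).symm.continuous.comp continuous_subtype_val)

theorem coe_pieceHomeo {α : V} (x : Piece α) :
    (pieceHomeo hT hb hf ρ α x : V → ℝ) = chart ρ hT hb hf α x.extend := rfl

theorem EdgeGluing.symm {x y : Σ α : V, Piece α} (h : EdgeGluing T x y) : EdgeGluing T y x :=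
  ⟨h.1.symm, h.2.1.symm, h.2.1 ▸ h.2.2.1, fun γ hy hx => (h.2.2.2 γ hx hy).symm⟩

/-- On `x_α = 0` the fold sends `(x_β, 0)` to `(x_β⁻, x_β⁺)`. This lands in the hyperplane of `β`
exactly when `x_β ≥ 0`, and then moves the value `x_β` to the place of `α`. -/
theorem edgeGluing_iff_fold {α β : V} (h : T.Adj β α) (x : Piece β) (y : Piece α) :
    EdgeGluing T ⟨β, x⟩ ⟨α, y⟩ ↔ fold h.ne y.extend = x.extend := by
  have hα : α ≠ β := h.ne'
  have hβ : β ≠ α := h.ne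
  constructor
  · rintro ⟨_, h1, h2, h3⟩
    simp only at h1 h2 h3
    ext γ
    by_cases hγα : γ = α
    · subst hγα
      rw [fold_apply_right, Piece.extend_self, Piece.extend_of_ne _ hα, Piece.extend_of_ne _ hβ,
        h1, max_eq_left (h1 ▸ h2), zero_add]
    · by_cases hγβ : γ = β
      · subst hγβ
        rw [fold_apply_left, Piece.extend_self, Piece.extend_self, Piece.extend_of_ne _ hβ,
          max_eq_right (neg_nonpos.mpr (h1 ▸ h2)), zero_add]
      · rw [fold_apply_of_ne _ _ hγβ hγα, Piece.extend_of_ne _ hγα, Piece.extend_of_ne _ hγβ,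
          h3 γ hγβ hγα]
  · intro hfold
    have e1 := congrFun hfold β
    have e2 := congrFun hfold α
    rw [fold_apply_left, Piece.extend_self, Piece.extend_self, Piece.extend_of_ne _ hβ, zero_add,
      max_eq_right_iff, neg_nonpos] at e1
    rw [fold_apply_right, Piece.extend_self, Piece.extend_of_ne _ hα, Piece.extend_of_ne _ hβ,
      zero_add, max_eq_left e1] at e2
    refine ⟨h, e2.symm, e1.trans_eq e2, fun γ hγβ hγα => ?_⟩
    have e3 := congrFun hfold γ
    rw [fold_apply_of_ne _ _ hγβ hγα, Piece.extend_of_ne _ hγα, Piece.extend_of_ne _ hγβ] at e3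
    exact e3.symm

/-- Along an edge, points of the two pieces are identified if and only if they have the same image
in `ℝ^V`. -/
theorem edgeGluing_iff {α β : V} (h : IsParent T ρ β α) (x : Piece β) (y : Piece α) :
    EdgeGluing T ⟨β, x⟩ ⟨α, y⟩ ↔
      (pieceHomeo hT hb hf ρ β x : V → ℝ) = pieceHomeo hT hb hf ρ α y := by
  rw [edgeGluing_iff_fold h.1, coe_pieceHomeo, coe_pieceHomeo, chart_of_isParent _ _ _ h]
  have hx : height T ρ f β (chart ρ hT hb hf β x.extend) = 0 := (pieceHomeo hT hb hf ρ β x).2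
  constructor
  · intro hfold
    rw [hfold, heightShear_eq_self _ _ _ _ hx]
  · intro heq
    -- The shear preserves `h_β` and is trivial where `h_β = 0`, so it can be cancelled.
    have h0 : height T ρ f β (chart ρ hT hb hf β (fold h.ne y.extend)) = 0 := by
      rw [← hx, heq, height_heightShear]
    rw [heightShear_eq_self _ _ _ _ h0] at heq
    exact ((chart ρ hT hb hf β).injective heq).symm

end Parametrization

/-! ### The comparison of the arboreal singularity with the coline bundle -/

section Comparison

theorem continuous_ofPiece {V : Type*} (T : SimpleGraph V) (α : V) : Continuous (Singularity.ofPiece T α) :=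
  continuous_quot_mk.comp continuous_sigmaMk

theorem exists_ofPiece_eq {V : Type*} {T : SimpleGraph V} (z : Singularity T) :
    ∃ α x, Singularity.ofPiece T α x = z := by
  obtain ⟨⟨α, x⟩, rfl⟩ := Quot.exists_rep z
  exact ⟨α, x, rfl⟩

variable {V : Type*} [Fintype V] {T : SimpleGraph V} {b : ℝ → ℝ} {f : ℝ × ℝ → ℝ}
variable (hT : T.IsTree) (ρ : V) (hb : IsProfile b) (hf : IsSmoothing b f)

theorem ray_eq_of_isParent {α β : V} (h : IsParent T ρ β α) (x : vertexHypersurface T ρ f β)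
    (y : vertexHypersurface T ρ f α) (hxy : (x : V → ℝ) = y) :
    (isRegularEquation_height hT hb hf β).ray x = (isRegularEquation_height hT hb hf α).ray y := by
  refine Prod.ext hxy ?_
  obtain ⟨c, hc, hcd⟩ := fderiv_height_of_parent_height_eq_zero hT hb hf h y.2 (hxy ▸ x.2)
  refine (ray_eq_iff _ _).mpr ?_
  change SameRay ℝ (fderiv ℝ (height T ρ f β) x) (fderiv ℝ (height T ρ f α) y)
  rw [hcd, hxy]
  exact SameRay.sameRay_pos_smul_right _ hc

theorem ray_eq_of_edgeGluing {x y : Σ α : V, Piece α} (h : EdgeGluing T x y) :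
    (isRegularEquation_height hT hb hf x.1).ray (pieceHomeo hT hb hf ρ x.1 x.2) =
      (isRegularEquation_height hT hb hf y.1).ray (pieceHomeo hT hb hf ρ y.1 y.2) := by
  rcases isParent_or_isParent_of_adj (ρ := ρ) hT h.1 with h' | h'
  · exact ray_eq_of_isParent hT ρ hb hf h' _ _ ((edgeGluing_iff hT hb hf h' _ _).mp h)
  · exact (ray_eq_of_isParent hT ρ hb hf h' _ _ ((edgeGluing_iff hT hb hf h' _ _).mp h.symm)).symm

/-- The map from the arboreal singularity to the cosphere bundle. -/
def singularityRay : Singularity T → CotangentRays (V → ℝ) :=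
  Quot.lift (fun x => (isRegularEquation_height hT hb hf x.1).ray (pieceHomeo hT hb hf ρ x.1 x.2))
    fun _ _ h => ray_eq_of_edgeGluing hT ρ hb hf h

theorem singularityRay_ofPiece (α : V) (x : Piece α) :
    singularityRay hT ρ hb hf (Singularity.ofPiece T α x) =
      (isRegularEquation_height hT hb hf α).ray (pieceHomeo hT hb hf ρ α x) := rfl

theorem continuous_singularityRay : Continuous (singularityRay hT ρ hb hf) :=
  continuous_quot_lift _ (continuous_sigma fun α =>
    (isRegularEquation_height hT hb hf α).continuous_ray.comp (pieceHomeo hT hb hf ρ α).continuous)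

/-- The map from the arboreal singularity to the projectivized cotangent bundle. -/
def singularityLine (z : Singularity T) : CotangentLines (V → ℝ) :=
  ((singularityRay hT ρ hb hf z).1, lineOfRay (singularityRay hT ρ hb hf z).2)

theorem singularityLine_ofPiece (α : V) (x : Piece α) :
    singularityLine hT ρ hb hf (Singularity.ofPiece T α x) =
      (isRegularEquation_height hT hb hf α).line (pieceHomeo hT hb hf ρ α x) :=
  (isRegularEquation_height hT hb hf α).lineOfRay_ray _

theorem continuous_singularityLine : Continuous (singularityLine hT ρ hb hf) :=
  (continuous_fst.comp (continuous_singularityRay hT ρ hb hf)).prodMk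
    (continuous_lineOfRay.comp (continuous_snd.comp (continuous_singularityRay hT ρ hb hf)))

open Classical in
/-- Every point of the singularity has a representative in a piece `γ` such that `dh_γ` has a
nonzero component along `x_γ`. -/
theorem exists_ofPiece_eq_fderiv_ne_zero (α : V) (x : Piece α) :
    ∃ (γ : V) (y : Piece γ), Singularity.ofPiece T γ y = Singularity.ofPiece T α x ∧
      fderiv ℝ (height T ρ f γ) (pieceHomeo hT hb hf ρ γ y) (Pi.single γ 1) ≠ 0 := by
  induction α using parent_induction (T := T) (ρ := ρ) with
  | root α hα =>
    refine ⟨α, x, rfl, ?_⟩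
    rw [fderiv_height_of_not_exists hα]
    simp
  | step α β hβ ih =>
    by_cases h0 : height T ρ f β (pieceHomeo hT hb hf ρ α x) = 0
    -- The image also lies on `H_β`, so the point is glued to one in the parent's piece.
    · let y : Piece β := (pieceHomeo hT hb hf ρ β).symm ⟨_, h0⟩
      have hy : EdgeGluing T ⟨β, y⟩ ⟨α, x⟩ := by
        rw [edgeGluing_iff hT hb hf hβ, Homeomorph.apply_symm_apply]
      obtain ⟨γ, w, hw, hd⟩ := ih y
      exact ⟨γ, w, hw.trans (Quot.sound hy), hd⟩
    · exact ⟨α, x, rfl, (fderiv_height_single_pos hT hb hf hβ (pieceHomeo hT hb hf ρ α x).2 h0).ne'⟩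

/-- With representatives as in `exists_ofPiece_eq_fderiv_ne_zero`, `γ` is the unique vertex at
greatest depth in the support of `dh_γ`, so the line recovers `γ`; the base point recovers the rest.
-/
theorem injective_singularityLine : Function.Injective (singularityLine hT ρ hb hf) := by
  classical
  intro z z' hz
  obtain ⟨α, x, rfl⟩ := exists_ofPiece_eq z
  obtain ⟨α', x', rfl⟩ := exists_ofPiece_eq z'
  obtain ⟨γ, y, hy, hd⟩ := exists_ofPiece_eq_fderiv_ne_zero hT ρ hb hf α x
  obtain ⟨γ', y', hy', hd'⟩ := exists_ofPiece_eq_fderiv_ne_zero hT ρ hb hf α' x'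
  rw [← hy, ← hy'] at hz ⊢
  rw [singularityLine_ofPiece, singularityLine_ofPiece] at hz
  have hpt : (pieceHomeo hT hb hf ρ γ y : V → ℝ) = pieceHomeo hT hb hf ρ γ' y' :=
    congrArg Prod.fst hz
  have hline := (Projectivization.mk_eq_mk_iff' ℝ _ _ _ _).mp (congrArg Prod.snd hz)
  obtain ⟨c, hc⟩ := hline
  change c • fderiv ℝ (height T ρ f γ') (pieceHomeo hT hb hf ρ γ' y') =
    fderiv ℝ (height T ρ f γ) (pieceHomeo hT hb hf ρ γ y) at hc
  have hγ : γ = γ' := by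
    by_contra hne
    -- The differential of the vertex nearer to the root has no component along the other vertex,
    -- contradicting proportionality.
    rcases le_total (T.dist ρ γ) (T.dist ρ γ') with hle | hle
    · have h0 := fderiv_height_single_eq_zero hT hf.contDiff (Ne.symm hne) hle
        (pieceHomeo hT hb hf ρ γ y)
      rw [← hc] at h0
      have hc0 : c = 0 := (mul_eq_zero.mp h0).resolve_right hd'
      rw [← hc, hc0] at hd
      simp at hd
    · have h0 := fderiv_height_single_eq_zero hT hf.contDiff hne hle
        (pieceHomeo hT hb hf ρ γ' y')
      rw [← hc] at hd
      exact hd (mul_eq_zero.mpr (Or.inr h0))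
  subst hγ
  rw [(pieceHomeo hT hb hf ρ γ).injective (Subtype.ext hpt)]

theorem singularityLine_mem (z : Singularity T) :
    singularityLine hT ρ hb hf z ∈ colineBundle (smoothedHypersurface T ρ f) := by
  obtain ⟨α, x, rfl⟩ := exists_ofPiece_eq z
  rw [singularityLine_ofPiece]
  exact line_mem_colineBundle_iUnion (isRegularEquation_height hT hb hf) α _

theorem singularityRay_mem (z : Singularity T) :
    singularityRay hT ρ hb hf z ∈ corayBundle (smoothedHypersurface T ρ f) := by
  obtain ⟨α, x, rfl⟩ := exists_ofPiece_eq z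
  exact ray_mem_corayBundle_iUnion (isRegularEquation_height hT hb hf) α _

/-- Each piece maps by a closed embedding and there are finitely many; this upgrades the continuous
bijection to a homeomorphism. -/
theorem isClosedMap_singularityLine : IsClosedMap (singularityLine hT ρ hb hf) := by
  intro C hC
  have : singularityLine hT ρ hb hf '' C = ⋃ α,
      (fun x => (isRegularEquation_height hT hb hf α).line (pieceHomeo hT hb hf ρ α x)) ''
        (Singularity.ofPiece T α ⁻¹' C) := by
    ext p
    rw [mem_iUnion]
    constructor
    · rintro ⟨z, hz, rfl⟩
      obtain ⟨α, x, rfl⟩ := exists_ofPiece_eq z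
      exact ⟨α, x, hz, (singularityLine_ofPiece hT ρ hb hf α x).symm⟩
    · rintro ⟨α, x, hx, rfl⟩
      exact ⟨_, hx, singularityLine_ofPiece hT ρ hb hf α x⟩
  rw [this]
  exact isClosed_iUnion_of_finite fun α =>
    ((isRegularEquation_height hT hb hf α).isClosedEmbedding_line.isClosedMap.comp
      (pieceHomeo hT hb hf ρ α).isClosedMap) _ (hC.preimage (continuous_ofPiece T α))

/-- The homeomorphism from the arboreal singularity to the coline bundle. -/
def singularityHomeo : Singularity T ≃ₜ colineBundle (smoothedHypersurface T ρ f) :=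
  (Equiv.ofBijective
    (fun z => (⟨singularityLine hT ρ hb hf z, singularityLine_mem hT ρ hb hf z⟩ :
      colineBundle (smoothedHypersurface T ρ f)))
    ⟨fun _ _ h => injective_singularityLine hT ρ hb hf (congrArg Subtype.val h), fun p => by
      obtain ⟨α, x, hx⟩ := exists_line_eq_of_mem_colineBundle
        (isRegularEquation_height hT hb hf) p.2
      refine ⟨Singularity.ofPiece T α ((pieceHomeo hT hb hf ρ α).symm x), Subtype.ext ?_⟩
      exact (singularityLine_ofPiece hT ρ hb hf α _).trans
        (((pieceHomeo hT hb hf ρ α).apply_symm_apply x).symm ▸ hx)⟩).toHomeomorphOfContinuousClosed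
    ((continuous_singularityLine hT ρ hb hf).subtype_mk _)
    fun C hC => by
      convert! (isClosedMap_singularityLine hT ρ hb hf C hC).preimage continuous_subtype_val
      ext p
      exact ⟨fun ⟨z, hz, h⟩ => ⟨z, hz, congrArg Subtype.val h⟩,
        fun ⟨z, hz, h⟩ => ⟨z, hz, Subtype.ext h⟩⟩

theorem coe_singularityHomeo (z : Singularity T) :
    (singularityHomeo hT ρ hb hf z : CotangentLines (V → ℝ)) = singularityLine hT ρ hb hf z := rfl

/-- The coorientation of the smoothed hypersurface by the rays of the differentials `dh_α`. -/
def smoothedCoorientation : Coorientation (smoothedHypersurface T ρ f) where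
  toFun p := ⟨singularityRay hT ρ hb hf ((singularityHomeo hT ρ hb hf).symm p),
    singularityRay_mem hT ρ hb hf _⟩
  continuous_toFun := ((continuous_singularityRay hT ρ hb hf).comp
    (singularityHomeo hT ρ hb hf).symm.continuous).subtype_mk _
  isSection p := by
    change singularityLine hT ρ hb hf ((singularityHomeo hT ρ hb hf).symm p) = p
    rw [← coe_singularityHomeo, Homeomorph.apply_symm_apply]

theorem smoothedCoorientation_apply (z : Singularity T) :
    ((smoothedCoorientation hT ρ hb hf).toFun (singularityHomeo hT ρ hb hf z)).1 =
      singularityRay hT ρ hb hf z := by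
  change singularityRay hT ρ hb hf
    ((singularityHomeo hT ρ hb hf).symm (singularityHomeo hT ρ hb hf z)) = _
  rw [Homeomorph.symm_apply_apply]

theorem smoothedCoorientation_restrictsTo (α : V) :
    (smoothedCoorientation hT ρ hb hf).RestrictsTo
      (isRegularEquation_height (ρ := ρ) hT hb hf α).coorientation := by
  intro p
  have h := isRegularEquation_height (ρ := ρ) hT hb hf α
  let z := Singularity.ofPiece T α ((pieceHomeo hT hb hf ρ α).symm ⟨front _ p, h.front_mem p⟩)
  have hz : (singularityHomeo hT ρ hb hf z : CotangentLines (V → ℝ)) = p := by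
    rw [coe_singularityHomeo, singularityLine_ofPiece, Homeomorph.apply_symm_apply]
    exact h.line_front p
  have hp : p.1 ∈ colineBundle (smoothedHypersurface T ρ f) :=
    hz ▸ (singularityHomeo hT ρ hb hf z).2
  refine ⟨hp, ?_⟩
  rw [show (⟨p.1, hp⟩ : colineBundle (smoothedHypersurface T ρ f)) =
    singularityHomeo hT ρ hb hf z from Subtype.ext hz.symm, smoothedCoorientation_apply,
    singularityRay_ofPiece, Homeomorph.apply_symm_apply]
  rfl

end Comparison

end Arboreal

end

open Arboreal
theorem mainTheorem2 {V : Type*} [Fintype V] (T : SimpleGraph V) (hT : T.IsTree) (ρ : V)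
    (b : ℝ → ℝ) (hb : IsProfile b) (f : ℝ × ℝ → ℝ) (hf : IsSmoothing b f) :
    IsInGoodPosition (smoothedHypersurface T ρ f) ∧
    (∀ α, IsInGoodPosition (vertexHypersurface T ρ f α)) ∧
    ∃ σv : ∀ α, Coorientation (vertexHypersurface T ρ f α),
      (∀ α p, PointsTowards ((σv α).toFun p).1 (halfspace T ρ f α)) ∧
      ∃ σ : Coorientation (smoothedHypersurface T ρ f),
        (∀ α, σ.RestrictsTo (σv α)) ∧
        (∀ σ' : Coorientation (smoothedHypersurface T ρ f),
          (∀ α, σ'.RestrictsTo (σv α)) → σ' = σ) ∧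
        ∃ φ : Singularity T ≃ₜ colineBundle (smoothedHypersurface T ρ f),
          (∀ α, ∃ ψ : Piece α ≃ₜ vertexHypersurface T ρ f α,
            ∀ x, front _ (φ (Singularity.ofPiece T α x)) = (ψ x : V → ℝ)) ∧
          ∃ φ' : Singularity T ≃ₜ σ.positiveRayBundle,
            ∀ z, (φ' z : CotangentRays (V → ℝ)) = (σ.toFun (φ z)).1 := by
  have hreg := isRegularEquation_height (ρ := ρ) hT hb hf
  refine ⟨isInGoodPosition_iUnion hreg, fun α => (hreg α).isInGoodPosition,
    fun α => (hreg α).coorientation, fun α p => (hreg α).pointsTowards_ray _,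
    smoothedCoorientation hT ρ hb hf, smoothedCoorientation_restrictsTo hT ρ hb hf,
    fun σ' hσ' => Coorientation.eq_of_restrictsTo hreg
      (smoothedCoorientation_restrictsTo hT ρ hb hf) hσ',
    singularityHomeo hT ρ hb hf, fun α => ⟨pieceHomeo hT hb hf ρ α, fun x => rfl⟩,
    (singularityHomeo hT ρ hb hf).trans
      (smoothedCoorientation hT ρ hb hf).homeoPositiveRayBundle, fun z => rfl⟩
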